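/- Notation. For an integer row matrix $A=(a_1\;\cdots\;a_n)$ and $\beta\in\mathbb C$, let $\mathcal D$ be the sheaf of linear differential operators with holomorphic coefficients on $X=\mathbb C^n$, with coordinates $x_1,\dots,x_n$ and $\partial_j=\partial/\partial x_j$. Let $H_A(\beta)$ be the left ideal of the Weyl algebra generated by $\sum_j a_jx_j\partial_j-\beta$ and by the binomials $\partial^{u_+}-\partial^{u_-}$ for all $u\in\mathbb Z^n$ with $\sum_j a_ju_j=0$ (where $u=u_+-u_-$ with $u_\pm\in\mathbb N^n$ of disjoint supports). The hypergeometric system is the sheaf of left $\mathcal D$-modules $\mathcal M_A(\beta)=\mathcal D/\mathcal D H_A(\beta)$. The restriction of $\mathcal M_A(\beta)$ to $X'=\{x_1=\cdots=x_m=0\}$ is the sheaf on $X'$ $$\frac{\mathcal D}{\mathcal D H_A(\beta)+(x_1,\dots,x_m)\mathcal D},$$ a left module over the sheaf $\mathcal D'$ of linear differential operators with holomorphic coefficients on $X'$ (operators in $x_{m+1},\dots,x_n$, acting by left multiplication). (1) Let $k,a,b$ be positive integers with $a<b$, $1<ka$ and $\gcd(a,b)=1$, and let $A=(1\; ka\;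 kb)$ and $A'=(a\; b)$. Then for every $\beta\in\mathbb C$ there exist $\beta_0,\dots,\beta_{k-1}\in\mathbb C$ and an isomorphism of sheaves of left $\mathcal D'$-modules on $\{x_1=0\}$ $$\frac{\mathcal D}{\mathcal D H_A(\beta)+x_1\mathcal D}\;\simeq\;\bigoplus_{i=0}^{k-1}\mathcal M_{A'}(\beta_i).$$ Moreover, for all but finitely many $\beta\in\mathbb C$ one can take $\beta_i=\frac{\beta-i}{k}$ for $i=0,\dots,k-1$. (2) Let $n\ge 2$, let $A=(1\; a_2\;\cdots\; a_n)$ be an integer row matrix with $1<a_2<\cdots<a_n$ (and $a_1=1$), and let $A'=(a_{n-1}\; a_n)$ and $k=\gcd(a_{n-1},a_n)$. Then for every $\beta\in\mathbb C$ there exist $\beta_0,\dots,\beta_{k-1}\in\mathbb C$ and an isomorphism of sheaves of left $\mathcal D'$-modules on $\{x_1=\cdots=x_{n-2}=0\}$ $$\frac{\mathcal D}{\mathcal D H_A(\beta)+(x_1,\dots,x_{n-2})\mathcal D}\;\simeq\;\bigoplus_{i=0}^{k-1}\mathcal M_{A'}(\beta_i).$$ Moreover, for all but finitely many $\beta\in\mathbb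 C$ one can take $\beta_i=\beta-i$ for $i=0,\dots,k-1$. -/

import Mathlib

open Filter Topology TopologicalSpace

noncomputable section

namespace GKZ

/-! ### Germs of holomorphic functions on `ℂⁿ` -/

/-- The stalk `𝒪_{X,p}` of the sheaf of holomorphic functions on `X = ℂⁿ`. -/
def HolGerm {n : ℕ} (p : Fin n → ℂ) : Subring (Germ (𝓝 p) ℂ) where
  carrier := {φ | ∃ f : (Fin n → ℂ) → ℂ, AnalyticAt ℂ f p ∧ (f : Germ (𝓝 p) ℂ) = φ}
  mul_mem' := by
    rintro _ _ ⟨f, hf, rfl⟩ ⟨g, hg, rfl⟩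
    exact ⟨f * g, hf.mul hg, rfl⟩
  one_mem' := ⟨1, analyticAt_const, rfl⟩
  add_mem' := by
    rintro _ _ ⟨f, hf, rfl⟩ ⟨g, hg, rfl⟩
    exact ⟨f + g, hf.add hg, rfl⟩
  zero_mem' := ⟨0, analyticAt_const, rfl⟩
  neg_mem' := by
    rintro _ ⟨f, hf, rfl⟩
    exact ⟨-f, hf.neg, rfl⟩

/-- The germ at `p` of a function that is holomorphic near `p`. -/
def germ {n : ℕ} {p : Fin n → ℂ} (f : (Fin n → ℂ) → ℂ) (hf : AnalyticAt ℂ f p) : HolGerm p :=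
  ⟨(f : Germ (𝓝 p) ℂ), f, hf, rfl⟩

/-- The germ of the `j`-th coordinate function. -/
def coord {n : ℕ} {p : Fin n → ℂ} (j : Fin n) : HolGerm p :=
  germ (fun x => x j)
    ((ContinuousLinearMap.proj (R := ℂ) (φ := fun _ : Fin n => ℂ) j).analyticAt p)

/-- The germ of a constant function. -/
def constGerm {n : ℕ} {p : Fin n → ℂ} (c : ℂ) : HolGerm p :=
  germ (fun _ => c) analyticAt_const

/-- The `i`-th partial derivative of a function on `ℂⁿ`. -/
def partialFun {n : ℕ} (i : Fin n) (f : (Fin n → ℂ) → ℂ) : (Fin n → ℂ) → ℂ :=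
  fun x => fderiv ℂ f x (Pi.single i 1)

theorem analyticAt_partialFun {n : ℕ} {p : Fin n → ℂ} (i : Fin n) {f : (Fin n → ℂ) → ℂ}
    (hf : AnalyticAt ℂ f p) : AnalyticAt ℂ (partialFun i f) p :=
  ((ContinuousLinearMap.apply ℂ ℂ (Pi.single i 1 : Fin n → ℂ)).analyticAt _).comp hf.fderiv

/-- The `i`-th partial derivative of a holomorphic germ. -/
def partialGerm {n : ℕ} {p : Fin n → ℂ} (i : Fin n) (φ : HolGerm p) : HolGerm p :=
  ⟨Germ.map' (partialFun i) (fun _ _ h => h.fderiv.fun_comp fun L => L (Pi.single i 1)) φ.1, by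
    obtain ⟨_, f, hf, rfl⟩ := φ
    exact ⟨partialFun i f, analyticAt_partialFun i hf, rfl⟩⟩

/-! ### The sheaf of linear differential operators with holomorphic coefficients -/

/-- The defining relations of the stalk of `𝒟` at `p`, in the generators `f ∈ 𝒪_p` (left summand)
and `∂₁, …, ∂ₙ` (right summand). -/
inductive DRel {n : ℕ} (p : Fin n → ℂ) :
    FreeAlgebra ℂ (HolGerm p ⊕ Fin n) → FreeAlgebra ℂ (HolGerm p ⊕ Fin n) → Prop
  | add (f g : HolGerm p) : DRel p (FreeAlgebra.ι ℂ (Sum.inl (f + g)))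
      (FreeAlgebra.ι ℂ (Sum.inl f) + FreeAlgebra.ι ℂ (Sum.inl g))
  | mul (f g : HolGerm p) : DRel p (FreeAlgebra.ι ℂ (Sum.inl (f * g)))
      (FreeAlgebra.ι ℂ (Sum.inl f) * FreeAlgebra.ι ℂ (Sum.inl g))
  | const (c : ℂ) : DRel p (FreeAlgebra.ι ℂ (Sum.inl (constGerm c)))
      (algebraMap ℂ (FreeAlgebra ℂ (HolGerm p ⊕ Fin n)) c)
  | comm (i j : Fin n) : DRel p
      (FreeAlgebra.ι ℂ (Sum.inr i) * FreeAlgebra.ι ℂ (Sum.inr j))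
      (FreeAlgebra.ι ℂ (Sum.inr j) * FreeAlgebra.ι ℂ (Sum.inr i))
  | leibniz (i : Fin n) (f : HolGerm p) : DRel p
      (FreeAlgebra.ι ℂ (Sum.inr i) * FreeAlgebra.ι ℂ (Sum.inl f))
      (FreeAlgebra.ι ℂ (Sum.inl f) * FreeAlgebra.ι ℂ (Sum.inr i)
        + FreeAlgebra.ι ℂ (Sum.inl (partialGerm i f)))

/-- The stalk `𝒟_{X,p} = 𝒪_{X,p}⟨∂₁, …, ∂ₙ⟩` of the sheaf of linear differential operators with
holomorphic coefficients on `X = ℂⁿ`: the `ℂ`-algebra generated by the algebra `𝒪_{X,p}` and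
commuting symbols `∂ᵢ` with `∂ᵢ f = f ∂ᵢ + ∂f/∂xᵢ`. -/
def DStalk {n : ℕ} (p : Fin n → ℂ) : Type := RingQuot (DRel p)

instance {n : ℕ} (p : Fin n → ℂ) : Ring (DStalk p) := inferInstanceAs (Ring (RingQuot (DRel p)))

instance {n : ℕ} (p : Fin n → ℂ) : Algebra ℂ (DStalk p) :=
  inferInstanceAs (Algebra ℂ (RingQuot (DRel p)))

/-- The canonical map from the free algebra. -/
def DStalk.mk {n : ℕ} (p : Fin n → ℂ) : FreeAlgebra ℂ (HolGerm p ⊕ Fin n) →ₐ[ℂ] DStalk p :=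
  RingQuot.mkAlgHom ℂ (DRel p)

theorem DStalk.mk_surjective {n : ℕ} (p : Fin n → ℂ) : Function.Surjective (DStalk.mk p) :=
  RingQuot.mkAlgHom_surjective ℂ (DRel p)

theorem DStalk.mk_rel {n : ℕ} {p : Fin n → ℂ} {x y : FreeAlgebra ℂ (HolGerm p ⊕ Fin n)}
    (h : DRel p x y) : DStalk.mk p x = DStalk.mk p y :=
  RingQuot.mkAlgHom_rel ℂ h

/-- A holomorphic germ as an operator of order zero. -/
def fn {n : ℕ} {p : Fin n → ℂ} (f : HolGerm p) : DStalk p :=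
  DStalk.mk p (FreeAlgebra.ι ℂ (Sum.inl f))

/-- The operator `∂ᵢ`. -/
def pd {n : ℕ} {p : Fin n → ℂ} (i : Fin n) : DStalk p :=
  DStalk.mk p (FreeAlgebra.ι ℂ (Sum.inr i))

theorem fn_add {n : ℕ} {p : Fin n → ℂ} (f g : HolGerm p) : fn (f + g) = fn f + fn g := by
  simpa [fn] using DStalk.mk_rel (DRel.add f g)

theorem fn_mul {n : ℕ} {p : Fin n → ℂ} (f g : HolGerm p) : fn (f * g) = fn f * fn g := by
  simpa [fn] using DStalk.mk_rel (DRel.mul f g)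

theorem fn_const {n : ℕ} {p : Fin n → ℂ} (c : ℂ) :
    fn (constGerm c : HolGerm p) = algebraMap ℂ (DStalk p) c := by
  simpa [fn] using DStalk.mk_rel (DRel.const (p := p) c)

theorem pd_comm {n : ℕ} {p : Fin n → ℂ} (i j : Fin n) :
    (pd i * pd j : DStalk p) = pd j * pd i := by
  simpa [pd] using DStalk.mk_rel (DRel.comm (p := p) i j)

theorem pd_fn {n : ℕ} {p : Fin n → ℂ} (i : Fin n) (f : HolGerm p) :
    pd i * fn f = fn f * pd i + fn (partialGerm i f) := by
  simpa [pd, fn] using DStalk.mk_rel (DRel.leibniz i f)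

/-- The universal property of the stalk of `𝒟`. -/
def DStalk.lift {n : ℕ} {p : Fin n → ℂ} {B : Type} [Ring B] [Algebra ℂ B]
    (F : HolGerm p → B) (d : Fin n → B)
    (hadd : ∀ f g, F (f + g) = F f + F g) (hmul : ∀ f g, F (f * g) = F f * F g)
    (hconst : ∀ c, F (constGerm c) = algebraMap ℂ B c) (hcomm : ∀ i j, d i * d j = d j * d i)
    (hleib : ∀ i f, d i * F f = F f * d i + F (partialGerm i f)) : DStalk p →ₐ[ℂ] B :=
  RingQuot.liftAlgHom ℂ ⟨FreeAlgebra.lift ℂ (Sum.elim F d), by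
    rintro _ _ (⟨f, g⟩ | ⟨f, g⟩ | ⟨c⟩ | ⟨i, j⟩ | ⟨i, f⟩)
    · simpa using hadd f g
    · simpa using hmul f g
    · simpa using hconst c
    · simpa using hcomm i j
    · simpa using hleib i f⟩

theorem DStalk.lift_mk {n : ℕ} {p : Fin n → ℂ} {B : Type} [Ring B] [Algebra ℂ B]
    (F : HolGerm p → B) (d : Fin n → B) (h1 h2 h3 h4 h5) (x : HolGerm p ⊕ Fin n) :
    DStalk.lift F d h1 h2 h3 h4 h5 (DStalk.mk p (FreeAlgebra.ι ℂ x)) = Sum.elim F d x :=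
  (RingQuot.liftAlgHom_mkAlgHom_apply ℂ _ _ _).trans (FreeAlgebra.lift_ι_apply _ _)

/-- Restriction of families indexed by the points of an open set. -/
def resFun {n : ℕ} {F : (Fin n → ℂ) → Type} {V U : Opens (Fin n → ℂ)} (h : V ≤ U)
    (s : ∀ q : U, F q.1) : ∀ q : V, F q.1 :=
  fun q => s ⟨q.1, h q.2⟩

/-- The operators `∑ f_α ∂^α` on the open set `V`, with finitely many terms and coefficients
holomorphic on `V`, as families of germs: the algebra generated by the holomorphic functions
on `V` and the `∂ᵢ`. -/
def DPre {n : ℕ} (V : Opens (Fin n → ℂ)) : Subalgebra ℂ (∀ q : V, DStalk q.1) :=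
  Algebra.adjoin ℂ
    ({P | ∃ (f : (Fin n → ℂ) → ℂ) (hf : ∀ q : V, AnalyticAt ℂ f q.1),
        P = fun q => fn (germ f (hf q))} ∪
      Set.range fun i : Fin n => fun _ : V => pd i)

theorem resFun_mem_DPre {n : ℕ} {V W : Opens (Fin n → ℂ)} (h : W ≤ V)
    {P : ∀ q : V, DStalk q.1} (hP : P ∈ DPre V) : resFun (F := DStalk) h P ∈ DPre W := by
  let ρ : (∀ q : V, DStalk q.1) →ₐ[ℂ] (∀ q : W, DStalk q.1) :=
    { toFun := resFun (F := DStalk) h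
      map_one' := rfl
      map_mul' := fun _ _ => rfl
      map_zero' := rfl
      map_add' := fun _ _ => rfl
      commutes' := fun _ => rfl }
  have key : DPre V ≤ (DPre W).comap ρ := by
    refine Algebra.adjoin_le ?_
    rintro _ (⟨f, hf, rfl⟩ | ⟨i, rfl⟩)
    · exact Algebra.subset_adjoin (Or.inl ⟨f, fun q => hf ⟨q.1, h q.2⟩, rfl⟩)
    · exact Algebra.subset_adjoin (Or.inr ⟨i, rfl⟩)
  exact key hP

/-- The sections over `U` of the sheaf `𝒟` of linear differential operators with holomorphic
coefficients: families of germs that are locally given by operators `∑ f_α ∂^α`. -/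
def DSec {n : ℕ} (U : Opens (Fin n → ℂ)) : Subalgebra ℂ (∀ q : U, DStalk q.1) where
  carrier := {P | ∀ p : U, ∃ (V : Opens (Fin n → ℂ)) (h : V ≤ U), p.1 ∈ V ∧
    resFun (F := DStalk) h P ∈ DPre V}
  mul_mem' := by
    intro P Q hP hQ p
    obtain ⟨V, hV, hpV, h1⟩ := hP p
    obtain ⟨W, hW, hpW, h2⟩ := hQ p
    exact ⟨V ⊓ W, inf_le_left.trans hV, ⟨hpV, hpW⟩,
      mul_mem (resFun_mem_DPre inf_le_left h1) (resFun_mem_DPre inf_le_right h2)⟩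
  add_mem' := by
    intro P Q hP hQ p
    obtain ⟨V, hV, hpV, h1⟩ := hP p
    obtain ⟨W, hW, hpW, h2⟩ := hQ p
    exact ⟨V ⊓ W, inf_le_left.trans hV, ⟨hpV, hpW⟩,
      add_mem (resFun_mem_DPre inf_le_left h1) (resFun_mem_DPre inf_le_right h2)⟩
  algebraMap_mem' := fun c p => ⟨U, le_rfl, p.2, (DPre U).algebraMap_mem c⟩

theorem resFun_mem_DSec {n : ℕ} {U V : Opens (Fin n → ℂ)} (h : V ≤ U)
    {P : ∀ q : U, DStalk q.1} (hP : P ∈ DSec U) : resFun (F := DStalk) h P ∈ DSec V := by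
  intro p
  obtain ⟨W, hW, hpW, h1⟩ := hP ⟨p.1, h p.2⟩
  exact ⟨W ⊓ V, inf_le_right, ⟨hpW, p.2⟩, resFun_mem_DPre inf_le_left h1⟩

/-! ### Hypergeometric systems of a row matrix -/

/-- The monomial `∂^u = ∂₁^{u₁} ⋯ ∂ₙ^{uₙ}`. -/
def pdPow {n : ℕ} {p : Fin n → ℂ} (u : Fin n → ℕ) : DStalk p :=
  (List.ofFn fun i => (pd i : DStalk p) ^ u i).prod

/-- The binomial `□_u = ∂^{u₊} - ∂^{u₋}`. -/
def box {n : ℕ} {p : Fin n → ℂ} (u : Fin n → ℤ) : DStalk p :=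
  pdPow (fun i => (u i).toNat) - pdPow (fun i => (-u i).toNat)

/-- The Euler operator `E_A(β) = ∑ⱼ aⱼ xⱼ ∂ⱼ - β`. -/
def euler {n : ℕ} {p : Fin n → ℂ} (A : Fin n → ℤ) (β : ℂ) : DStalk p :=
  ∑ j, (A j : ℂ) • (fn (coord j) * pd j) - algebraMap ℂ (DStalk p) β

/-- The stalk at `p` of the left ideal `𝒟 H_A(β)`, generated by the `□_u` with `A u = 0` and by
the Euler operator. -/
def hypIdeal {n : ℕ} (A : Fin n → ℤ) (β : ℂ) (p : Fin n → ℂ) :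
    Submodule (DStalk p) (DStalk p) :=
  Submodule.span (DStalk p)
    ({P | ∃ u : Fin n → ℤ, ∑ j, A j * u j = 0 ∧ P = box u} ∪ {euler A β})

/-- The stalk at `p` of `ℳ_A(β) = 𝒟 / 𝒟 H_A(β)`. -/
abbrev MStalk {n : ℕ} (A : Fin n → ℤ) (β : ℂ) (p : Fin n → ℂ) : Type :=
  DStalk p ⧸ hypIdeal A β p

/-- The `𝒟(U)`-module of sections over `U` of the quotient sheaf `ℳ_A(β) = 𝒟 / 𝒟 H_A(β)`:
families of classes of germs that are locally induced by sections of `𝒟`. -/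
def MSec {n : ℕ} (A : Fin n → ℤ) (β : ℂ) (U : Opens (Fin n → ℂ)) :
    Submodule (DSec U) (∀ q : U, MStalk A β q.1) where
  carrier := {s | ∀ p : U, ∃ (V : Opens (Fin n → ℂ)) (h : V ≤ U), p.1 ∈ V ∧
    ∃ P ∈ DSec V, ∀ q : V, s ⟨q.1, h q.2⟩ = (hypIdeal A β q.1).mkQ (P q)}
  add_mem' := by
    intro s t hs ht p
    obtain ⟨V, hV, hpV, P, hP, h1⟩ := hs p
    obtain ⟨W, hW, hpW, Q, hQ, h2⟩ := ht p
    refine ⟨V ⊓ W, inf_le_left.trans hV, ⟨hpV, hpW⟩, _,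
      add_mem (resFun_mem_DSec inf_le_left hP) (resFun_mem_DSec inf_le_right hQ), fun q => ?_⟩
    have e1 := h1 ⟨q.1, q.2.1⟩
    have e2 := h2 ⟨q.1, q.2.2⟩
    simp only [Pi.add_apply, resFun, map_add] at e1 e2 ⊢
    rw [e1, e2]
  zero_mem' := fun p => ⟨U, le_rfl, p.2, 0, zero_mem _, fun q => by simp⟩
  smul_mem' := by
    intro Q s hs p
    obtain ⟨V, hV, hpV, P, hP, h1⟩ := hs p
    refine ⟨V, hV, hpV, _, mul_mem (resFun_mem_DSec hV Q.2) hP, fun q => ?_⟩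
    change Q.1 ⟨q.1, hV q.2⟩ • s ⟨q.1, hV q.2⟩ =
      (hypIdeal A β q.1).mkQ (Q.1 ⟨q.1, hV q.2⟩ • P q)
    rw [h1 q, map_smul]

/-- The restriction maps of the sheaf `ℳ_A(β)`. -/
def MSec.res {n : ℕ} {A : Fin n → ℤ} {β : ℂ} {U V : Opens (Fin n → ℂ)} (h : V ≤ U)
    (s : MSec A β U) : MSec A β V :=
  ⟨resFun (F := MStalk A β) h s.1, by
    intro p
    obtain ⟨W, hW, hpW, P, hP, h1⟩ := s.2 ⟨p.1, h p.2⟩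
    exact ⟨W ⊓ V, inf_le_right, ⟨hpW, p.2⟩, _, resFun_mem_DSec inf_le_left hP,
      fun q => h1 ⟨q.1, q.2.1⟩⟩⟩

/-! ### Restriction to `x₁ = ⋯ = xₘ = 0` -/

/-- The inclusion `X' = ℂʳ → X = ℂ^{m+r}` of the subspace `x₁ = ⋯ = xₘ = 0`. -/
def incl (m : ℕ) {r : ℕ} (p : Fin r → ℂ) : Fin (m + r) → ℂ := Fin.append 0 p

/-- The projection `X = ℂ^{m+r} → X' = ℂʳ` to the last `r` coordinates. -/
def projL (m r : ℕ) : (Fin (m + r) → ℂ) →L[ℂ] (Fin r → ℂ) :=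
  ContinuousLinearMap.pi fun j => ContinuousLinearMap.proj (Fin.natAdd m j)

theorem projL_incl (m : ℕ) {r : ℕ} (p : Fin r → ℂ) : projL m r (incl m p) = p := by
  ext j
  simp [projL, incl]

theorem continuous_incl (m r : ℕ) : Continuous (incl m : (Fin r → ℂ) → (Fin (m + r) → ℂ)) := by
  refine continuous_pi fun i => ?_
  refine Fin.addCases (fun i => ?_) (fun i => ?_) i
  · simpa [incl] using continuous_const
  · simpa [incl] using continuous_apply i

theorem tendsto_projL (m : ℕ) {r : ℕ} (p : Fin r → ℂ) :
    Tendsto (projL m r) (𝓝 (incl m p)) (𝓝 p) := by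
  simpa only [projL_incl] using (projL m r).continuous.tendsto (incl m p)

theorem analyticAt_comp_projL (m : ℕ) {r : ℕ} {q : Fin (m + r) → ℂ} {f : (Fin r → ℂ) → ℂ}
    (hf : AnalyticAt ℂ f (projL m r q)) : AnalyticAt ℂ (fun x => f (projL m r x)) q :=
  AnalyticAt.comp (g := f) hf ((projL m r).analyticAt q)

/-- A germ in `x_{m+1}, …, x_{m+r}` regarded as a germ in all the variables. -/
def pull (m : ℕ) {r : ℕ} {p : Fin r → ℂ} (φ : HolGerm p) : HolGerm (incl m p) :=
  ⟨φ.1.compTendsto (projL m r) (tendsto_projL m p), by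
    obtain ⟨_, f, hf, rfl⟩ := φ
    exact ⟨fun x => f (projL m r x), analyticAt_comp_projL m (by rwa [projL_incl]), rfl⟩⟩

theorem partialGerm_pull (m : ℕ) {r : ℕ} {p : Fin r → ℂ} (j : Fin r) (φ : HolGerm p) :
    partialGerm (Fin.natAdd m j) (pull m φ) = pull m (partialGerm j φ) := by
  obtain ⟨_, f, hf, rfl⟩ := φ
  apply Subtype.ext
  refine Germ.coe_eq.2 ?_
  filter_upwards [(tendsto_projL m p).eventually hf.eventually_analyticAt] with x hx
  change fderiv ℂ (fun y => f (projL m r y)) x _ = fderiv ℂ f (projL m r x) _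
  have h : HasFDerivAt (fun y => f (projL m r y))
      ((fderiv ℂ f (projL m r x)).comp (projL m r)) x :=
    hx.differentiableAt.hasFDerivAt.comp x (projL m r).hasFDerivAt
  rw [h.fderiv]
  change fderiv ℂ f (projL m r x) _ = _
  congr 1
  ext i
  by_cases hij : i = j
  · subst hij; simp [projL]
  · simp [projL, hij]

/-- The inclusion `𝒟' → 𝒟` of the operators in the last `r` variables. -/
def extOp (m : ℕ) {r : ℕ} (p : Fin r → ℂ) : DStalk p →ₐ[ℂ] DStalk (incl m p) :=
  DStalk.lift (fun f => fn (pull m f)) (fun j => pd (Fin.natAdd m j))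
    (fun f g => by
      rw [← fn_add]; congr 1
      obtain ⟨_, f, hf, rfl⟩ := f
      obtain ⟨_, g, hg, rfl⟩ := g
      rfl)
    (fun f g => by
      rw [← fn_mul]; congr 1
      obtain ⟨_, f, hf, rfl⟩ := f
      obtain ⟨_, g, hg, rfl⟩ := g
      rfl)
    (fun c => fn_const c) (fun i j => pd_comm _ _)
    (fun i f => by rw [pd_fn, partialGerm_pull])

theorem extOp_fn (m : ℕ) {r : ℕ} (p : Fin r → ℂ) (f : HolGerm p) :
    extOp m p (fn f) = fn (pull m f) :=
  DStalk.lift_mk _ _ _ _ _ _ _ (Sum.inl f)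

theorem extOp_pd (m : ℕ) {r : ℕ} (p : Fin r → ℂ) (j : Fin r) :
    extOp m p (pd j) = pd (Fin.natAdd m j) :=
  DStalk.lift_mk _ _ _ _ _ _ _ (Sum.inr j)

/-- The operators in the last variables commute with the first coordinates. -/
theorem extOp_mul_coord (m : ℕ) {r : ℕ} (p : Fin r → ℂ) (i : Fin m) (Q : DStalk p) :
    extOp m p Q * fn (coord (Fin.castAdd r i)) = fn (coord (Fin.castAdd r i)) * extOp m p Q := by
  obtain ⟨x, rfl⟩ := DStalk.mk_surjective p Q
  induction x using FreeAlgebra.induction with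
  | grade0 c => simp only [AlgHom.commutes]; exact Algebra.commutes c _
  | grade1 y =>
    rcases y with f | j
    · change extOp m p (fn f) * _ = _ * extOp m p (fn f)
      rw [extOp_fn, ← fn_mul, ← fn_mul, mul_comm]
    · change extOp m p (pd j) * _ = _ * extOp m p (pd j)
      rw [extOp_pd, pd_fn]
      have h0 : partialGerm (Fin.natAdd m j) (coord (Fin.castAdd r i) : HolGerm (incl m p))
          = constGerm 0 := by
        apply Subtype.ext
        refine Germ.coe_eq.2 (Eventually.of_forall fun x => ?_)
        change fderiv ℂ (ContinuousLinearMap.proj (R := ℂ) (φ := fun _ : Fin (m + r) => ℂ)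
          (Fin.castAdd r i)) x _ = 0
        rw [ContinuousLinearMap.fderiv]
        have hne : Fin.castAdd r i ≠ Fin.natAdd m j := by
          intro h
          have := congrArg Fin.val h
          simp at this
          omega
        simp [hne]
      rw [h0, fn_const]
      simp
  | mul x y hx hy => simp only [map_mul]; rw [mul_assoc, hy, ← mul_assoc, hx, mul_assoc]
  | add x y hx hy => simp only [map_add]; rw [add_mul, hx, hy, mul_add]

/-- The stalk of `𝒟` at the point `p` of `X' = {x₁ = ⋯ = xₘ = 0}`, as a left `𝒟'`-module. -/
def DExt (m : ℕ) {r : ℕ} (p : Fin r → ℂ) : Type := DStalk (incl m p)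

instance (m : ℕ) {r : ℕ} (p : Fin r → ℂ) : AddCommGroup (DExt m p) :=
  inferInstanceAs (AddCommGroup (DStalk (incl m p)))

instance (m : ℕ) {r : ℕ} (p : Fin r → ℂ) : Module (DStalk p) (DExt m p) :=
  Module.compHom (DStalk (incl m p)) (extOp m p).toRingHom

/-- The stalk at a point of `X'` of `𝒟 H_A(β) + (x₁, …, xₘ) 𝒟`, as a left `𝒟'`-submodule
of `𝒟`. -/
def restrSub {m r : ℕ} (A : Fin (m + r) → ℤ) (β : ℂ) (p : Fin r → ℂ) :
    Submodule (DStalk p) (DExt m p) where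
  carrier := {P | ∃ H ∈ hypIdeal A β (incl m p), ∃ C : Fin m → DStalk (incl m p),
    P = (H + ∑ i, fn (coord (Fin.castAdd r i)) * C i : DStalk (incl m p))}
  add_mem' := by
    rintro _ _ ⟨H, hH, C, rfl⟩ ⟨K, hK, E, rfl⟩
    refine ⟨H + K, add_mem hH hK, C + E, ?_⟩
    simp only [Pi.add_apply, mul_add, Finset.sum_add_distrib]
    exact add_add_add_comm (G := DStalk (incl m p)) _ _ _ _
  zero_mem' := ⟨0, zero_mem _, 0, by simp; rfl⟩
  smul_mem' := by
    rintro Q _ ⟨H, hH, C, rfl⟩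
    refine ⟨extOp m p Q * H, Submodule.smul_mem _ (extOp m p Q) hH, fun i => extOp m p Q * C i, ?_⟩
    change extOp m p Q * (H + _) = _
    rw [mul_add, Finset.mul_sum]
    congr 1
    refine Finset.sum_congr rfl fun i _ => ?_
    rw [← mul_assoc, extOp_mul_coord, mul_assoc]

/-- The stalk at `p ∈ X'` of `𝒟 / (𝒟 H_A(β) + (x₁, …, xₘ) 𝒟)`. -/
abbrev RStalk {m r : ℕ} (A : Fin (m + r) → ℤ) (β : ℂ) (p : Fin r → ℂ) : Type :=
  DExt m p ⧸ restrSub A β p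

/-- The class in `𝒟 / (𝒟 H_A(β) + (x₁, …, xₘ) 𝒟)` of a germ of an operator. -/
def RStalk.mk {m r : ℕ} (A : Fin (m + r) → ℤ) (β : ℂ) (p : Fin r → ℂ)
    (P : DStalk (incl m p)) : RStalk A β p :=
  (restrSub A β p).mkQ P

/-- The inverse image in `X` of an open subset of `X'`. -/
def cyl (m : ℕ) {r : ℕ} (U : Opens (Fin r → ℂ)) : Opens (Fin (m + r) → ℂ) :=
  ⟨projL m r ⁻¹' U, U.2.preimage (projL m r).continuous⟩

/-- The open subset `V ∩ X'` of `X'`. -/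
def slice {m r : ℕ} (V : Opens (Fin (m + r) → ℂ)) : Opens (Fin r → ℂ) :=
  ⟨incl m ⁻¹' V, V.2.preimage (continuous_incl m r)⟩

/-- Sections of `𝒟'` over `U` extend to sections of `𝒟` over the inverse image of `U`. -/
theorem exists_extOp_mem_DPre (m : ℕ) {r : ℕ} {U : Opens (Fin r → ℂ)} {Q : ∀ q : U, DStalk q.1}
    (hQ : Q ∈ DPre U) : ∃ P ∈ DPre (cyl m U), ∀ (q : U) (hq : incl m q.1 ∈ cyl m U),
      P ⟨incl m q.1, hq⟩ = extOp m q.1 (Q q) := by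
  refine Algebra.adjoin_induction (p := fun Q _ => ∃ P ∈ DPre (cyl m U),
    ∀ (q : U) (hq : incl m q.1 ∈ cyl m U), P ⟨incl m q.1, hq⟩ = extOp m q.1 (Q q))
    ?_ ?_ ?_ ?_ hQ
  · rintro _ (⟨f, hf, rfl⟩ | ⟨i, rfl⟩)
    · refine ⟨_, Algebra.subset_adjoin (Or.inl ⟨fun x => f (projL m r x),
        fun q => analyticAt_comp_projL m (hf ⟨_, q.2⟩), rfl⟩), fun q hq => ?_⟩
      rw [extOp_fn]
      rfl
    · refine ⟨_, Algebra.subset_adjoin (Or.inr ⟨Fin.natAdd m i, rfl⟩), fun q hq => ?_⟩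
      rw [extOp_pd]
  · intro c
    exact ⟨_, (DPre (cyl m U)).algebraMap_mem c, fun q hq => ((extOp m q.1).commutes c).symm⟩
  · rintro x y _ _ ⟨P, hP, h1⟩ ⟨P', hP', h2⟩
    refine ⟨P + P', add_mem hP hP', fun q hq => ?_⟩
    rw [Pi.add_apply, Pi.add_apply, h1, h2, map_add]
  · rintro x y _ _ ⟨P, hP, h1⟩ ⟨P', hP', h2⟩
    refine ⟨P * P', mul_mem hP hP', fun q hq => ?_⟩
    rw [Pi.mul_apply, Pi.mul_apply, h1, h2, map_mul]

theorem mem_DSec_of_mem_DPre {n : ℕ} {V : Opens (Fin n → ℂ)} {P : ∀ q : V, DStalk q.1}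
    (hP : P ∈ DPre V) : P ∈ DSec V :=
  fun p => ⟨V, le_rfl, p.2, hP⟩

/-- The `𝒟'(U)`-module of sections over the open set `U ⊆ X'` of the restriction
`𝒟 / (𝒟 H_A(β) + (x₁, …, xₘ) 𝒟)` of `ℳ_A(β)` to `X' = {x₁ = ⋯ = xₘ = 0}`: families of classes of
germs at the points of `U` that are locally induced by sections of `𝒟` over open subsets of `X`. -/
def RSec {m r : ℕ} (A : Fin (m + r) → ℤ) (β : ℂ) (U : Opens (Fin r → ℂ)) :
    Submodule (DSec U) (∀ q : U, RStalk A β q.1) where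
  carrier := {s | ∀ p : U, ∃ V : Opens (Fin (m + r) → ℂ), incl m p.1 ∈ V ∧
    ∃ P ∈ DSec V, ∀ (q : U) (hq : incl m q.1 ∈ V),
      s q = RStalk.mk A β q.1 (P ⟨incl m q.1, hq⟩)}
  add_mem' := by
    intro s t hs ht p
    obtain ⟨V, hpV, P, hP, h1⟩ := hs p
    obtain ⟨W, hpW, Q, hQ, h2⟩ := ht p
    refine ⟨V ⊓ W, ⟨hpV, hpW⟩, _,
      add_mem (resFun_mem_DSec inf_le_left hP) (resFun_mem_DSec inf_le_right hQ), fun q hq => ?_⟩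
    rw [Pi.add_apply, h1 q hq.1, h2 q hq.2]
    rfl
  zero_mem' := fun p => ⟨⊤, trivial, 0, zero_mem _, fun q _ => rfl⟩
  smul_mem' := by
    intro Q s hs p
    obtain ⟨V, hpV, P, hP, h1⟩ := hs p
    obtain ⟨W, hW, hpW, hQ⟩ := Q.2 p
    obtain ⟨Q', hQ', h2⟩ := exists_extOp_mem_DPre m hQ
    refine ⟨cyl m W ⊓ V, ⟨?_, hpV⟩, _, mul_mem
      (resFun_mem_DSec inf_le_left (mem_DSec_of_mem_DPre hQ')) (resFun_mem_DSec inf_le_right hP),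
      fun q hq => ?_⟩
    · change projL m r (incl m p.1) ∈ W
      rwa [projL_incl]
    · have hqW : q.1 ∈ W := by
        have : projL m r (incl m q.1) ∈ W := hq.1
        rwa [projL_incl] at this
      have e := h2 ⟨q.1, hqW⟩ hq.1
      change Q.1 q • s q = RStalk.mk A β q.1 (Q' ⟨incl m q.1, hq.1⟩ * P ⟨incl m q.1, hq.2⟩)
      rw [e, h1 q hq.2]
      rfl

/-- The restriction maps of the sheaf `𝒟 / (𝒟 H_A(β) + (x₁, …, xₘ) 𝒟)` on `X'`. -/
def RSec.res {m r : ℕ} {A : Fin (m + r) → ℤ} {β : ℂ} {U V : Opens (Fin r → ℂ)} (h : V ≤ U)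
    (s : RSec A β U) : RSec A β V :=
  ⟨resFun (F := RStalk A β) h s.1, by
    intro p
    obtain ⟨W, hpW, P, hP, h1⟩ := s.2 ⟨p.1, h p.2⟩
    exact ⟨W, hpW, P, hP, fun q hq => h1 ⟨q.1, h q.2⟩ hq⟩⟩

/-- `RestrictionIso A β A' b` says that, as sheaves of left `𝒟'`-modules on
`X' = {x₁ = ⋯ = xₘ = 0}`, there is an isomorphism
`𝒟 / (𝒟 H_A(β) + (x₁, …, xₘ) 𝒟) ≅ ⨁_{i < k} ℳ_{A'}(bᵢ)`: a family of `𝒟'(U)`-linear isomorphisms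
on sections over all open `U`, compatible with the restriction maps. -/
def RestrictionIso {m r k : ℕ} (A : Fin (m + r) → ℤ) (β : ℂ) (A' : Fin r → ℤ) (b : Fin k → ℂ) :
    Prop :=
  ∃ φ : ∀ U : Opens (Fin r → ℂ), RSec A β U ≃ₗ[DSec U] (∀ i : Fin k, MSec A' (b i) U),
    ∀ (U V : Opens (Fin r → ℂ)) (h : V ≤ U) (s : RSec A β U) (i : Fin k),
      φ V (RSec.res h s) i = MSec.res h (φ U s i)

end GKZ

end

/-!
Let `i₀` be an index with `A i₀ = 1`, and let `X` stand for `∂_{i₀}`. Modulo the toric binomials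
`∂ᵘ` becomes `X ^ (A ⬝ᵥ u)`, so `𝒟` modulo the toric ideal is `𝒪[X]`, through `P ↦ P · 1` for the
action in which `∂ᵢ` is `∂/∂xᵢ + X ^ A i`. Right multiplication by the Euler operator becomes the
endomorphism `E_β g = (∑ⱼ A j xⱼ X ^ A j) g + X g' - β g`, and the restriction becomes the cokernel
of the analogous endomorphism of `𝒪'[X]`, in which only the remaining variables occur. The class of
`X ^ l` is annihilated by `H_{A'}(β - l)`, where `A'` is the tail of `A`.

Let `S ⊆ ℕ` be the semigroup generated by `A'` and `k` the greatest common divisor of its entries.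
If `c₀, …, c_{k-1}` represent the residues modulo `k`, the translates `cᵢ + S` are disjoint and
cover all but finitely many `l`. For `l` outside their union the relation `E_β X ^ l = 0` expresses
`X ^ l` through higher powers, provided `β ≠ l`. Hence the classes of the `X ^ cᵢ` generate as soon
as `β` avoids the finitely many uncovered `l`. They satisfy no relations besides
`H_{A'}(β - cᵢ)`, because `E_β` preserves the polynomials supported on each `cᵢ + S`. Taking
`cᵢ = i` settles all but finitely many `β`; for the others, which lie in `ℕ`, take `β` itself as the
representative of its residue. A common factor `κ` of the tail is removed by
`H_{κA'}(κβ) = H_{A'}(β)`.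
-/

noncomputable section

namespace GKZ

section Hadamard

variable {𝕜 E F : Type*} [NontriviallyNormedField 𝕜] [NormedAddCommGroup E] [NormedSpace 𝕜 E]
  [NormedAddCommGroup F] [NormedSpace 𝕜 F]

/-- The power series of a divided difference: if `f` has the power series `p`, then `f y - f z` is
the value at `y - z` of the linear map represented at `(y, z)` by this series. -/
def divDiffSeries (p : FormalMultilinearSeries 𝕜 E F) :
    FormalMultilinearSeries 𝕜 (E × E) (E →L[𝕜] F) := fun n =>
  ∑ i : Fin (n + 1), ((p (n + 1)).curryMid i).flipMultilinear.compContinuousLinearMap fun j =>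
    if j.castSucc < i then ContinuousLinearMap.fst 𝕜 E E else ContinuousLinearMap.snd 𝕜 E E

theorem divDiffSeries_apply_sub (p : FormalMultilinearSeries 𝕜 E F) (n : ℕ) (y z : E) :
    divDiffSeries p n (fun _ => (y, z)) (y - z) =
      p (n + 1) (fun _ => y) - p (n + 1) (fun _ => z) := by
  have telescope := (p (n + 1)).toMultilinearMap.map_piecewise_sub_map_piecewise
    (fun _ => y) (fun _ => z) 0 Finset.univ
  simp only [Finset.piecewise_univ, Finset.mem_univ, if_true] at telescope
  refine Eq.trans ?_ telescope.symm
  simp only [divDiffSeries, sum_apply]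
  refine Finset.sum_congr rfl fun i _ => ?_
  simp only [ContinuousMultilinearMap.compContinuousLinearMap_apply,
    ContinuousLinearMap.flipMultilinear_apply_apply, ContinuousMultilinearMap.curryMid_apply]
  change p (n + 1) _ = p (n + 1) _
  congr 1
  funext j
  refine Fin.succAboveCases i ?_ (fun j => ?_) j
  · simp
  · rw [Fin.insertNth_apply_succAbove]
    rcases lt_or_ge j.castSucc i with hj | hj
    · simp [hj, Fin.succAbove_of_castSucc_lt]
    · have hij : i < j.succ := Fin.le_castSucc_iff.1 hj
      simp [hj.not_gt, Fin.succAbove_of_le_castSucc _ _ hj, hij.not_gt, hij.ne']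

theorem norm_divDiffSeries_le (p : FormalMultilinearSeries 𝕜 E F) (n : ℕ) :
    ‖divDiffSeries p n‖ ≤ (n + 1) * ‖p (n + 1)‖ := by
  have norm_summand_le : ∀ i : Fin (n + 1),
      ‖((p (n + 1)).curryMid i).flipMultilinear.compContinuousLinearMap fun j : Fin n =>
        if j.castSucc < i then ContinuousLinearMap.fst 𝕜 E E
        else ContinuousLinearMap.snd 𝕜 E E‖ ≤ ‖p (n + 1)‖ := by
    intro i
    refine (ContinuousMultilinearMap.norm_compContinuousLinearMap_le _ _).trans
      ((mul_le_of_le_one_right (norm_nonneg _) ?_).trans ?_)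
    · refine Finset.prod_le_one (fun _ _ => norm_nonneg _) fun j _ => ?_
      split_ifs
      exacts [ContinuousLinearMap.norm_fst_le 𝕜 E E, ContinuousLinearMap.norm_snd_le 𝕜 E E]
    · refine (MultilinearMap.mkContinuous_norm_le _ (norm_nonneg _) _).trans ?_
      rw [ContinuousMultilinearMap.norm_curryMid]
  refine (norm_sum_le_of_le (E := ContinuousMultilinearMap 𝕜 (fun _ : Fin n => E × E) (E →L[𝕜] F))
    Finset.univ fun i _ => norm_summand_le i).trans ?_
  simp

theorem radius_divDiffSeries_pos {p : FormalMultilinearSeries 𝕜 E F} (hp : 0 < p.radius) :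
    0 < (divDiffSeries p).radius := by
  obtain ⟨C, r, hC, hr, hbound⟩ := p.le_mul_pow_of_radius_pos hp
  have hr' : 0 < (2 * r)⁻¹ := by positivity
  refine lt_of_lt_of_le (ENNReal.coe_pos.2 (show (0 : NNReal) < ⟨(2 * r)⁻¹, hr'.le⟩ from hr'))
    ((divDiffSeries p).le_radius_of_bound (C * r) fun n => ?_)
  change ‖divDiffSeries p n‖ * (2 * r)⁻¹ ^ n ≤ C * r
  have hn : ((n : ℝ) + 1) ≤ 2 ^ n := by exact_mod_cast Nat.lt_two_pow_self
  calc ‖divDiffSeries p n‖ * (2 * r)⁻¹ ^ n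
      ≤ ((n + 1) * (C * r ^ (n + 1))) * (2 * r)⁻¹ ^ n := by
        gcongr
        exact (norm_divDiffSeries_le p n).trans (by gcongr; exact hbound (n + 1))
    _ ≤ (2 ^ n * (C * r ^ (n + 1))) * (2 * r)⁻¹ ^ n := by gcongr
    _ = C * r * ((2 * r) ^ n * (2 * r)⁻¹ ^ n) := by rw [mul_pow]; ring
    _ = C * r := by rw [← mul_pow, mul_inv_cancel₀ (by positivity), one_pow, mul_one]

theorem hasSum_divDiffSeries {p : FormalMultilinearSeries 𝕜 E F} {y z : E} {s t : F}
    (hy : HasSum (fun n => p n fun _ => y) s) (hz : HasSum (fun n => p n fun _ => z) t) :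
    HasSum (fun n => divDiffSeries p n (fun _ => (y, z)) (y - z)) (s - t) := by
  have h := hy.sub hz
  rw [← hasSum_nat_add_iff' 1] at h
  have h0 : p 0 (fun _ => y) = p 0 (fun _ => z) := by
    congr 1
    exact Subsingleton.elim _ _
  simpa only [Finset.range_one, Finset.sum_singleton, h0, sub_self, sub_zero,
    ← divDiffSeries_apply_sub] using h

theorem exists_analyticAt_divDiff [CompleteSpace F] {f : E → F} {x : E} (hf : AnalyticAt 𝕜 f x) :
    ∃ G : E × E → E →L[𝕜] F, AnalyticAt 𝕜 G (x, x) ∧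
      ∀ᶠ q in 𝓝 (x, x), f q.1 - f q.2 = G q (q.1 - q.2) := by
  obtain ⟨p, r, hp⟩ := hf
  set P := divDiffSeries p
  have hP : 0 < P.radius := radius_divDiffSeries_pos (hp.r_pos.trans_le hp.r_le)
  have hG := (P.hasFPowerSeriesOnBall hP).comp_sub (x, x)
  rw [zero_add] at hG
  refine ⟨fun q => P.sum (q - (x, x)), hG.analyticAt, ?_⟩
  filter_upwards [Metric.eball_mem_nhds (x, x) hP,
    continuousAt_fst.eventually (Metric.eball_mem_nhds x hp.r_pos),
    continuousAt_snd.eventually (Metric.eball_mem_nhds x hp.r_pos)] with ⟨y, z⟩ hyz hy hz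
  have hy' := hp.hasSum_sub hy
  have hz' := hp.hasSum_sub hz
  have hyz' : (y, z) - (x, x) ∈ Metric.eball (0 : E × E) P.radius := by
    simpa only [Metric.mem_eball, edist_eq_enorm_sub, sub_zero] using hyz
  have hsum := (P.hasSum hyz').mapL (ContinuousLinearMap.apply 𝕜 F (y - z))
  have hdiff := hasSum_divDiffSeries hy' hz'
  rw [sub_sub_sub_cancel_right] at hdiff
  exact hdiff.unique hsum

end Hadamard

section Germs

variable {n : ℕ} {p : Fin n → ℂ}

theorem exists_eq_germ (φ : HolGerm p) :
    ∃ (f : (Fin n → ℂ) → ℂ) (hf : AnalyticAt ℂ f p), φ = germ f hf := by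
  obtain ⟨_, f, hf, rfl⟩ := φ
  exact ⟨f, hf, rfl⟩

theorem germ_congr {f g : (Fin n → ℂ) → ℂ} {hf : AnalyticAt ℂ f p} {hg : AnalyticAt ℂ g p}
    (h : f =ᶠ[𝓝 p] g) : germ f hf = germ g hg :=
  Subtype.ext (Germ.coe_eq.2 h)

instance : Algebra ℂ (HolGerm p) :=
  RingHom.toAlgebra
    { toFun := constGerm
      map_one' := rfl
      map_mul' := fun _ _ => rfl
      map_zero' := rfl
      map_add' := fun _ _ => rfl }

theorem algebraMap_eq_constGerm (c : ℂ) : algebraMap ℂ (HolGerm p) c = constGerm c := rfl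

theorem sum_germ {ι : Type*} (s : Finset ι) {f : ι → (Fin n → ℂ) → ℂ}
    (hf : ∀ i, AnalyticAt ℂ (f i) p) : ∑ i ∈ s, germ (f i) (hf i) =
      germ (fun x => ∑ i ∈ s, f i x) (Finset.analyticAt_fun_sum s fun i _ => hf i) := by
  refine Subtype.ext ?_
  rw [AddSubmonoidClass.coe_finsetSum]
  refine (map_sum (Germ.coeRingHom (R := ℂ) (𝓝 p)) f s).symm.trans
    (Germ.coe_eq.2 (Eventually.of_forall fun x => ?_))
  simp

/-- The partial derivative `∂/∂xᵢ` as a derivation of the algebra of holomorphic germs. -/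
def partialDer (i : Fin n) : Derivation ℂ (HolGerm p) (HolGerm p) where
  toFun := partialGerm i
  map_add' φ ψ := by
    obtain ⟨f, hf, rfl⟩ := exists_eq_germ φ
    obtain ⟨g, hg, rfl⟩ := exists_eq_germ ψ
    refine germ_congr (hf := analyticAt_partialFun i (hf.add hg))
      (hg := (analyticAt_partialFun i hf).add (analyticAt_partialFun i hg)) ?_
    filter_upwards [hf.eventually_analyticAt, hg.eventually_analyticAt] with x hfx hgx
    simp [partialFun, fderiv_add hfx.differentiableAt hgx.differentiableAt]
  map_smul' c φ := by
    obtain ⟨f, hf, rfl⟩ := exists_eq_germ φ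
    refine germ_congr (hf := analyticAt_partialFun i (analyticAt_const.mul hf))
      (hg := analyticAt_const.mul (analyticAt_partialFun i hf)) ?_
    filter_upwards [hf.eventually_analyticAt] with x hfx
    simp [partialFun, fderiv_mul (differentiableAt_const c) hfx.differentiableAt]
  map_one_eq_zero' := by
    refine germ_congr (hf := analyticAt_partialFun i analyticAt_const) (hg := analyticAt_const)
      (Eventually.of_forall fun x => ?_)
    simp [partialFun]
  leibniz' φ ψ := by
    obtain ⟨f, hf, rfl⟩ := exists_eq_germ φ
    obtain ⟨g, hg, rfl⟩ := exists_eq_germ ψ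
    refine germ_congr (hf := analyticAt_partialFun i (hf.mul hg))
      (hg := (hf.mul (analyticAt_partialFun i hg)).add (hg.mul (analyticAt_partialFun i hf))) ?_
    filter_upwards [hf.eventually_analyticAt, hg.eventually_analyticAt] with x hfx hgx
    simp [partialFun, fderiv_mul hfx.differentiableAt hgx.differentiableAt]

theorem partialDer_apply (i : Fin n) (φ : HolGerm p) : partialDer i φ = partialGerm i φ := rfl

theorem partialFun_partialFun {f : (Fin n → ℂ) → ℂ} {x : Fin n → ℂ} (hf : AnalyticAt ℂ f x)
    (i j : Fin n) : partialFun i (partialFun j f) x =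
      fderiv ℂ (fderiv ℂ f) x (Pi.single i 1) (Pi.single j 1) := by
  have h := (hf.fderiv.differentiableAt.hasFDerivAt.clm_apply
    (hasFDerivAt_const (Pi.single j 1 : Fin n → ℂ) x)).fderiv
  change fderiv ℂ (fun y => fderiv ℂ f y (Pi.single j 1)) x (Pi.single i 1) = _
  rw [h]
  simp

theorem partialGerm_comm (i j : Fin n) (φ : HolGerm p) :
    partialGerm i (partialGerm j φ) = partialGerm j (partialGerm i φ) := by
  obtain ⟨f, hf, rfl⟩ := exists_eq_germ φ
  refine germ_congr (hf := analyticAt_partialFun i (analyticAt_partialFun j hf))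
    (hg := analyticAt_partialFun j (analyticAt_partialFun i hf)) ?_
  filter_upwards [hf.eventually_analyticAt] with x hfx
  rw [partialFun_partialFun hfx, partialFun_partialFun hfx]
  exact (hfx.contDiffAt (n := 2)).isSymmSndFDerivAt (by simp) _ _

theorem analyticAt_coord (j : Fin n) (p : Fin n → ℂ) : AnalyticAt ℂ (fun x : Fin n → ℂ => x j) p :=
  (ContinuousLinearMap.proj (R := ℂ) (φ := fun _ : Fin n => ℂ) j).analyticAt p

theorem partialGerm_coord (i j : Fin n) :
    partialGerm i (coord j : HolGerm p) = if i = j then 1 else 0 := by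
  have partialFun_coord : ∀ x : Fin n → ℂ,
      partialFun i (fun x => x j) x = if i = j then 1 else 0 := by
    intro x
    change fderiv ℂ (ContinuousLinearMap.proj (R := ℂ) (φ := fun _ : Fin n => ℂ) j) x _ = _
    rw [ContinuousLinearMap.fderiv]
    simp [Pi.single_apply, eq_comm]
  split_ifs with hij <;>
    refine germ_congr (hf := analyticAt_partialFun i (analyticAt_coord j p))
      (hg := analyticAt_const) (Eventually.of_forall fun x => ?_)
  exacts [(partialFun_coord x).trans (if_pos hij), (partialFun_coord x).trans (if_neg hij)]

end Germs

section CoefficientwiseDerivative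

open Polynomial

variable {n : ℕ} {p : Fin n → ℂ}

/-- The partial derivative `∂/∂xᵢ` applied to the coefficients of a polynomial over the germs of
holomorphic functions. -/
def coeffDer (i : Fin n) : Derivation ℂ (HolGerm p)[X] (HolGerm p)[X] :=
  PolynomialModule.equivPolynomialSelf.compDer (partialDer i).mapCoeffs

theorem coeff_coeffDer (i : Fin n) (g : (HolGerm p)[X]) (l : ℕ) :
    (coeffDer i g).coeff l = partialDer i (g.coeff l) := rfl

theorem coeffDer_C (i : Fin n) (f : HolGerm p) : coeffDer i (C f) = C (partialGerm i f) := by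
  ext1 l
  rw [coeff_coeffDer, coeff_C, coeff_C, ← partialDer_apply]
  split_ifs <;> simp

theorem coeffDer_X_pow (i : Fin n) (k : ℕ) : coeffDer i (X ^ k : (HolGerm p)[X]) = 0 := by
  ext1 l
  rw [coeff_coeffDer, coeff_X_pow]
  split_ifs <;> simp

theorem coeffDer_comm (i j : Fin n) (g : (HolGerm p)[X]) :
    coeffDer i (coeffDer j g) = coeffDer j (coeffDer i g) := by
  ext1 l
  simp only [coeff_coeffDer, partialDer_apply, partialGerm_comm i j]

theorem coeffDer_derivative (i : Fin n) (g : (HolGerm p)[X]) :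
    coeffDer i (derivative g) = derivative (coeffDer i g) := by
  ext1 l
  have h : partialDer (p := p) i ((l : HolGerm p) + 1) = 0 := by simp
  simp only [coeff_coeffDer, coeff_derivative]
  rw [Derivation.leibniz, h, smul_zero, zero_add, smul_eq_mul, mul_comm]

theorem coeffDer_X_pow_mul (i : Fin n) (k : ℕ) (g : (HolGerm p)[X]) :
    coeffDer i (X ^ k * g) = X ^ k * coeffDer i g := by
  rw [Derivation.leibniz, coeffDer_X_pow, smul_zero, add_zero, smul_eq_mul]

end CoefficientwiseDerivative

section Restriction

variable {m r : ℕ} {p : Fin r → ℂ}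

theorem castAdd_ne_natAdd (i : Fin m) (j : Fin r) : Fin.castAdd r i ≠ Fin.natAdd m j :=
  Fin.ne_of_lt (show (i : ℕ) < m + j from i.2.trans_le (Nat.le_add_right m j))

theorem incl_castAdd (x : Fin r → ℂ) (i : Fin m) : incl m x (Fin.castAdd r i) = 0 := by
  simp [incl]

theorem incl_natAdd (x : Fin r → ℂ) (j : Fin r) : incl m x (Fin.natAdd m j) = x j := by
  simp [incl]

/-- The inclusion of the subspace `x₁ = ⋯ = xₘ = 0`, as a continuous linear map. -/
def inclL (m r : ℕ) : (Fin r → ℂ) →L[ℂ] (Fin (m + r) → ℂ) where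
  toFun := incl m
  map_add' x y := by
    ext i; cases i using Fin.addCases <;> simp [incl]
  map_smul' c x := by
    ext i; cases i using Fin.addCases <;> simp [incl]
  cont := continuous_incl m r

theorem inclL_apply (x : Fin r → ℂ) : inclL m r x = incl m x := rfl

theorem inclL_single (j : Fin r) (c : ℂ) :
    inclL m r (Pi.single j c) = Pi.single (Fin.natAdd m j) c := by
  ext i
  cases i using Fin.addCases with
  | left i => simp [inclL_apply, incl_castAdd, castAdd_ne_natAdd]
  | right i => simp [inclL_apply, incl_natAdd, Pi.single_apply]

theorem analyticAt_comp_incl {f : (Fin (m + r) → ℂ) → ℂ} (hf : AnalyticAt ℂ f (incl m p)) :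
    AnalyticAt ℂ (fun x => f (incl m x)) p :=
  AnalyticAt.comp (g := f) (f := inclL m r) hf ((inclL m r).analyticAt p)

/-- The restriction of holomorphic germs to the subspace `x₁ = ⋯ = xₘ = 0`. -/
def restr (m : ℕ) {r : ℕ} (p : Fin r → ℂ) : HolGerm (incl m p) →ₐ[ℂ] HolGerm p where
  toFun φ := ⟨φ.1.compTendsto (incl m) (continuous_incl m r).continuousAt, by
    obtain ⟨_, f, hf, rfl⟩ := φ
    exact ⟨fun x => f (incl m x), analyticAt_comp_incl hf, rfl⟩⟩
  map_one' := rfl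
  map_zero' := rfl
  map_mul' := by
    rintro ⟨_, f, hf, rfl⟩ ⟨_, g, hg, rfl⟩
    rfl
  map_add' := by
    rintro ⟨_, f, hf, rfl⟩ ⟨_, g, hg, rfl⟩
    rfl
  commutes' _ := rfl

theorem restr_pull (φ : HolGerm p) : restr m p (pull m φ) = φ := by
  obtain ⟨f, hf, rfl⟩ := exists_eq_germ φ
  refine germ_congr (hf := analyticAt_comp_incl (analyticAt_comp_projL m (by rwa [projL_incl])))
    (hg := hf) (Eventually.of_forall fun x => ?_)
  simp [projL_incl]

theorem restr_partialGerm (j : Fin r) (φ : HolGerm (incl m p)) :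
    restr m p (partialGerm (Fin.natAdd m j) φ) = partialGerm j (restr m p φ) := by
  obtain ⟨f, hf, rfl⟩ := exists_eq_germ φ
  refine germ_congr (hf := analyticAt_comp_incl (analyticAt_partialFun _ hf))
    (hg := analyticAt_partialFun j (analyticAt_comp_incl hf)) ?_
  filter_upwards [(continuous_incl m r).continuousAt.eventually hf.eventually_analyticAt] with x hx
  have h : HasFDerivAt (fun y => f (inclL m r y)) ((fderiv ℂ f (incl m x)).comp (inclL m r)) x :=
    HasFDerivAt.comp x hx.differentiableAt.hasFDerivAt (inclL m r).hasFDerivAt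
  change fderiv ℂ f (incl m x) _ = fderiv ℂ (fun y => f (inclL m r y)) x _
  rw [h.fderiv, ContinuousLinearMap.comp_apply, inclL_single]

theorem restr_coord_castAdd (i : Fin m) : restr m p (coord (Fin.castAdd r i)) = 0 :=
  germ_congr (hf := analyticAt_comp_incl (analyticAt_coord _ _)) (hg := analyticAt_const)
    (Eventually.of_forall fun x => incl_castAdd x i)

theorem restr_coord_natAdd (j : Fin r) : restr m p (coord (Fin.natAdd m j)) = coord j :=
  germ_congr (hf := analyticAt_comp_incl (analyticAt_coord _ _)) (hg := analyticAt_coord _ _)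
    (Eventually.of_forall fun x => incl_natAdd x j)

theorem sub_incl_projL (x : Fin (m + r) → ℂ) : x - incl m (projL m r x) =
    ∑ i : Fin m, x (Fin.castAdd r i) • (Pi.single (Fin.castAdd r i) 1 : Fin (m + r) → ℂ) := by
  ext i
  cases i using Fin.addCases with
  | left i => simp [incl_castAdd, Finset.sum_apply, Pi.single_apply]
  | right j => simp [incl_natAdd, projL, Finset.sum_apply, (castAdd_ne_natAdd _ _).symm]

theorem exists_eq_pull_restr_add (φ : HolGerm (incl m p)) :
    ∃ C : Fin m → HolGerm (incl m p),
      φ = pull m (restr m p φ) + ∑ i, coord (Fin.castAdd r i) * C i := by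
  obtain ⟨f, hf, rfl⟩ := exists_eq_germ φ
  obtain ⟨G, hG, hfG⟩ := exists_analyticAt_divDiff hf
  set e : Fin m → Fin (m + r) → ℂ := fun i => Pi.single (Fin.castAdd r i) 1
  set τ : (Fin (m + r) → ℂ) →L[ℂ] (Fin (m + r) → ℂ) × (Fin (m + r) → ℂ) :=
    (ContinuousLinearMap.id ℂ _).prod ((inclL m r).comp (projL m r)) with hτ
  have hτp : τ (incl m p) = (incl m p, incl m p) := by simp [hτ, projL_incl, inclL_apply]
  have hC : ∀ i, AnalyticAt ℂ (fun x => G (τ x) (e i)) (incl m p) := fun i =>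
    ((ContinuousLinearMap.apply ℂ ℂ (e i)).analyticAt _).comp
      (AnalyticAt.comp (g := G) (by rwa [hτp]) (τ.analyticAt _))
  refine ⟨fun i => germ _ (hC i), ?_⟩
  rw [show ∑ i, coord (Fin.castAdd r i) * germ _ (hC i) = _ from
    sum_germ Finset.univ fun i => (analyticAt_coord (Fin.castAdd r i) _).mul (hC i)]
  refine germ_congr (hg := (analyticAt_comp_projL m
    (by rw [projL_incl]; exact analyticAt_comp_incl hf)).add (Finset.analyticAt_fun_sum _
      fun i _ => (analyticAt_coord (Fin.castAdd r i) _).mul (hC i))) ?_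
  filter_upwards [(τ.continuous.tendsto' _ _ hτp).eventually hfG] with x hx
  change f x - f (incl m (projL m r x)) = G (τ x) (x - incl m (projL m r x)) at hx
  rw [sub_incl_projL, map_sum] at hx
  simp only [map_smul, smul_eq_mul] at hx
  exact eq_add_of_sub_eq' hx

end Restriction

section Monomials

theorem multiIndex_induction {n : ℕ} {motive : (Fin n → ℕ) → Prop} (u : Fin n → ℕ)
    (zero : motive 0) (add : ∀ u v, motive u → motive v → motive (u + v))
    (single : ∀ i, motive (Pi.single i 1)) : motive u := by
  refine Pi.single_induction motive u zero add fun i k => ?_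
  induction k with
  | zero => rwa [Pi.single_zero]
  | succ k ih => rw [Pi.single_add]; exact add _ _ ih (single i)

variable {M : Type*} [Monoid M]

theorem prod_ofFn_pow_add : ∀ {n : ℕ} {d : Fin n → M}, (∀ i j, Commute (d i) (d j)) →
    ∀ u v : Fin n → ℕ, (List.ofFn fun i => d i ^ (u + v) i).prod =
      (List.ofFn fun i => d i ^ u i).prod * (List.ofFn fun i => d i ^ v i).prod
  | 0, _, _, _, _ => by simp
  | n + 1, d, hd, u, v => by
    have ih := prod_ofFn_pow_add (fun i j => hd i.succ j.succ) (fun i => u i.succ)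
      (fun i => v i.succ)
    have hcomm : Commute (d 0 ^ v 0) (List.ofFn fun i : Fin n => d i.succ ^ u i.succ).prod :=
      Commute.list_prod_right _ _ fun x hx => by
        obtain ⟨i, rfl⟩ := List.mem_ofFn.1 hx
        exact (hd 0 i.succ).pow_pow _ _
    simp only [Pi.add_apply] at ih
    simp only [List.ofFn_succ, List.prod_cons, Pi.add_apply]
    rw [ih, pow_add (d 0), mul_assoc, ← mul_assoc (d 0 ^ v 0), hcomm.eq]
    simp only [mul_assoc]

theorem prod_ofFn_pow_single : ∀ {n : ℕ} (d : Fin n → M) (i : Fin n) (k : ℕ),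
    (List.ofFn fun j => d j ^ (Pi.single i k : Fin n → ℕ) j).prod = d i ^ k
  | n + 1, d, i, k => by
    rw [List.ofFn_succ, List.prod_cons]
    cases i using Fin.cases with
    | zero => simp
    | succ i =>
      have ih := prod_ofFn_pow_single (fun j => d j.succ) i k
      simpa [Pi.single_apply] using ih

end Monomials

section Operators

variable {n : ℕ} {p : Fin n → ℂ}

/-- The inclusion of the holomorphic germs into the differential operators, as an algebra
homomorphism. -/
def fnHom : HolGerm p →ₐ[ℂ] DStalk p where
  toFun := fn
  map_one' := (fn_const 1).trans (map_one _)
  map_mul' := fn_mul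
  map_zero' := (fn_const 0).trans (map_zero _)
  map_add' := fn_add
  commutes' := fn_const

theorem fnHom_apply (f : HolGerm p) : fnHom f = fn f := rfl

theorem DStalk.adjoin_eq_top :
    Algebra.adjoin ℂ (((fnHom (p := p)).range : Set (DStalk p)) ∪ Set.range pd) = ⊤ := by
  refine Algebra.eq_top_iff.2 fun P => ?_
  obtain ⟨x, rfl⟩ := DStalk.mk_surjective p P
  induction x using FreeAlgebra.induction with
  | grade0 c => rw [AlgHom.commutes]; exact Subalgebra.algebraMap_mem _ c
  | grade1 y =>
    rcases y with f | i
    · exact Algebra.subset_adjoin (Or.inl ⟨f, rfl⟩)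
    · exact Algebra.subset_adjoin (Or.inr ⟨i, rfl⟩)
  | mul x y hx hy => rw [map_mul]; exact mul_mem hx hy
  | add x y hx hy => rw [map_add]; exact add_mem hx hy

theorem DStalk.induction {motive : DStalk p → Prop} (P : DStalk p)
    (const : ∀ c, motive (algebraMap ℂ _ c)) (fn : ∀ f, motive (fn f)) (pd : ∀ i, motive (pd i))
    (add : ∀ P Q, motive P → motive Q → motive (P + Q))
    (mul : ∀ P Q, motive P → motive Q → motive (P * Q)) : motive P := by
  have hP : P ∈ Algebra.adjoin ℂ
      (((fnHom (p := p)).range : Set (DStalk p)) ∪ Set.range GKZ.pd) := by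
    simp only [DStalk.adjoin_eq_top, Algebra.mem_top]
  induction hP using Algebra.adjoin_induction with
  | mem x hx =>
    rcases hx with ⟨f, rfl⟩ | ⟨i, rfl⟩
    exacts [fn f, pd i]
  | algebraMap c => exact const c
  | add x y _ _ hx hy => exact add x y hx hy
  | mul x y _ _ hx hy => exact mul x y hx hy

theorem pdPow_zero : (pdPow 0 : DStalk p) = 1 := by
  simp [pdPow]

theorem pdPow_add (u v : Fin n → ℕ) : (pdPow (u + v) : DStalk p) = pdPow u * pdPow v :=
  prod_ofFn_pow_add pd_comm u v

theorem pdPow_single (i : Fin n) (k : ℕ) : (pdPow (Pi.single i k) : DStalk p) = pd i ^ k :=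
  prod_ofFn_pow_single pd i k

theorem pdPow_single_one (i : Fin n) : (pdPow (Pi.single i 1) : DStalk p) = pd i := by
  rw [pdPow_single, pow_one]

end Operators

section NormalForm

/-- Normal ordering: the factors from `D` can be moved to the right of the coefficients. -/
theorem adjoin_union_subset_span {R B : Type*} [CommRing R] [Ring B] [Algebra R B]
    {S : Subalgebra R B} {D : Set B} {W : Submonoid B} (hDW : D ⊆ W)
    (hcomm : ∀ d ∈ D, ∀ s ∈ S, d * s - s * d ∈ S) {P : B}
    (hP : P ∈ Algebra.adjoin R ((S : Set B) ∪ D)) : P ∈ Submodule.span S (W : Set B) := by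
  suffices hmul : ∀ Q ∈ Submodule.span S (W : Set B), P * Q ∈ Submodule.span S (W : Set B) by
    simpa using hmul 1 (Submodule.subset_span W.one_mem)
  induction hP using Algebra.adjoin_induction with
  | mem x hx =>
    rcases hx with hs | hd
    · exact fun Q hQ => Submodule.smul_mem _ (⟨x, hs⟩ : S) hQ
    · intro Q hQ
      induction hQ using Submodule.span_induction with
      | mem w hw => exact Submodule.subset_span (W.mul_mem (hDW hd) hw)
      | zero => rw [mul_zero]; exact zero_mem _
      | add Q Q' _ _ hQ hQ' => rw [mul_add]; exact add_mem hQ hQ'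
      | smul s Q hQ hxQ =>
        have hmove : x * s • Q = s • (x * Q) + (⟨_, hcomm x hd s s.2⟩ : S) • Q := by
          simp only [Subalgebra.smul_def, smul_eq_mul]
          noncomm_ring
        rw [hmove]
        exact add_mem (Submodule.smul_mem _ _ hxQ) (Submodule.smul_mem _ _ hQ)
  | algebraMap c => exact fun Q hQ => Submodule.smul_mem _ (algebraMap R S c) hQ
  | add x y _ _ hx hy => exact fun Q hQ => by rw [add_mul]; exact add_mem (hx Q hQ) (hy Q hQ)
  | mul x y _ _ hx hy => exact fun Q hQ => by rw [mul_assoc]; exact hx _ (hy Q hQ)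

variable {n : ℕ}

theorem DStalk.induction_normalForm {p : Fin n → ℂ} {motive : DStalk p → Prop} (P : DStalk p)
    (zero : motive 0) (add : ∀ P Q, motive P → motive Q → motive (P + Q))
    (fn_mul_pdPow : ∀ f u, motive (fn f * pdPow u)) : motive P := by
  let monomials : Submonoid (DStalk p) :=
    { carrier := Set.range pdPow
      one_mem' := ⟨0, pdPow_zero⟩
      mul_mem' := by
        rintro _ _ ⟨u, rfl⟩ ⟨v, rfl⟩
        exact ⟨u + v, pdPow_add u v⟩ }
  have hP : P ∈ Submodule.span (fnHom (p := p)).range (monomials : Set (DStalk p)) := by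
    refine adjoin_union_subset_span (R := ℂ) (D := Set.range pd) ?_ ?_
      (by simp only [DStalk.adjoin_eq_top, Algebra.mem_top])
    · rintro _ ⟨i, rfl⟩
      exact ⟨_, pdPow_single_one i⟩
    · rintro _ ⟨i, rfl⟩ _ ⟨f, rfl⟩
      exact ⟨partialGerm i f, eq_sub_of_add_eq' (pd_fn i f).symm⟩
  induction hP using Submodule.closure_induction with
  | zero => exact zero
  | add x y _ _ hx hy => exact add x y hx hy
  | smul_mem s x hx =>
    obtain ⟨⟨_, f, rfl⟩, u, rfl⟩ := s, hx
    exact fn_mul_pdPow f u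

/-- The holomorphic functions on `V`, as families of operators of order zero. -/
def holFamilies (V : Opens (Fin n → ℂ)) : Subalgebra ℂ (∀ q : V, DStalk q.1) where
  carrier := {P | ∃ (f : (Fin n → ℂ) → ℂ) (hf : ∀ q : V, AnalyticAt ℂ f q.1),
    P = fun q => fn (germ f (hf q))}
  mul_mem' := by
    rintro _ _ ⟨f, hf, rfl⟩ ⟨g, hg, rfl⟩
    exact ⟨f * g, fun q => (hf q).mul (hg q), funext fun q => (fn_mul _ _).symm⟩
  add_mem' := by
    rintro _ _ ⟨f, hf, rfl⟩ ⟨g, hg, rfl⟩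
    exact ⟨f + g, fun q => (hf q).add (hg q), funext fun q => (fn_add _ _).symm⟩
  algebraMap_mem' c := ⟨fun _ => c, fun _ => analyticAt_const, funext fun _ => (fn_const c).symm⟩

theorem DPre.induction_normalForm {V : Opens (Fin n → ℂ)}
    {motive : (∀ q : V, DStalk q.1) → Prop} {P : ∀ q : V, DStalk q.1} (hP : P ∈ DPre V)
    (zero : motive 0) (add : ∀ P Q, motive P → motive Q → motive (P + Q))
    (fn_mul_pdPow : ∀ (f : (Fin n → ℂ) → ℂ) (hf : ∀ q : V, AnalyticAt ℂ f q.1) (u : Fin n → ℕ),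
      motive fun q => fn (germ f (hf q)) * pdPow u) : motive P := by
  let monomials : Submonoid (∀ q : V, DStalk q.1) :=
    { carrier := Set.range fun u _ => pdPow u
      one_mem' := ⟨0, funext fun _ => pdPow_zero⟩
      mul_mem' := by
        rintro _ _ ⟨u, rfl⟩ ⟨v, rfl⟩
        exact ⟨u + v, funext fun _ => pdPow_add u v⟩ }
  have hP' : P ∈ Submodule.span (holFamilies V) (monomials : Set (∀ q : V, DStalk q.1)) := by
    have hP' : P ∈ Algebra.adjoin ℂ ((holFamilies V : Set (∀ q : V, DStalk q.1)) ∪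
        Set.range fun i _ => pd i) := hP
    refine adjoin_union_subset_span ?_ ?_ hP'
    · rintro _ ⟨i, rfl⟩
      exact ⟨_, funext fun _ => pdPow_single_one i⟩
    · rintro _ ⟨i, rfl⟩ _ ⟨f, hf, rfl⟩
      exact ⟨partialFun i f, fun q => analyticAt_partialFun i (hf q),
        funext fun q => sub_eq_of_eq_add' (pd_fn i (germ f (hf q)))⟩
  clear hP
  induction hP' using Submodule.closure_induction with
  | zero => exact zero
  | add x y _ _ hx hy => exact add x y hx hy
  | smul_mem s x hx =>
    obtain ⟨⟨_, f, hf, rfl⟩, u, rfl⟩ := s, hx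
    exact fn_mul_pdPow f hf u

end NormalForm

section Toric

variable {n : ℕ} {p : Fin n → ℂ}

theorem pd_mul_euler (A : Fin n → ℤ) (β : ℂ) (i : Fin n) :
    (pd i * euler A β : DStalk p) = euler A (β - A i) * pd i := by
  have hterm : ∀ j, (pd i * (A j : ℂ) • (fn (coord j) * pd j) : DStalk p) =
      ((A j : ℂ) • (fn (coord j) * pd j)) * pd i + if i = j then (A j : ℂ) • pd j else 0 := by
    intro j
    rw [mul_smul_comm, ← mul_assoc, pd_fn, add_mul, mul_assoc, pd_comm i j, smul_add,
      ← mul_assoc, smul_mul_assoc, partialGerm_coord]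
    split_ifs
    · rw [show fn 1 = (1 : DStalk p) from map_one fnHom, one_mul]
    · rw [show fn 0 = (0 : DStalk p) from map_zero fnHom, zero_mul, smul_zero]
  simp only [euler, mul_sub, sub_mul, Finset.mul_sum, Finset.sum_mul, hterm,
    Finset.sum_add_distrib, Finset.sum_ite_eq, Finset.mem_univ, if_true, map_sub]
  rw [← Algebra.commutes β, Algebra.smul_def (A i : ℂ) (pd i)]
  abel

theorem pdPow_mul_euler (A : Fin n → ℤ) (β : ℂ) (u : Fin n → ℕ) :
    (pdPow u * euler A β : DStalk p) = euler A (β - ∑ j, (A j : ℂ) * u j) * pdPow u := by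
  induction u using multiIndex_induction generalizing β with
  | zero => simp [pdPow_zero]
  | add u v hu hv =>
    rw [pdPow_add, mul_assoc, hv, ← mul_assoc, hu, mul_assoc, sub_sub,
      ← Finset.sum_add_distrib]
    simp only [Pi.add_apply, Nat.cast_add, mul_add, add_comm]
  | single i =>
    rw [pdPow_single_one, pd_mul_euler]
    simp [Pi.single_apply]

/-- The integer row matrix with the natural number entries `a`. -/
abbrev row (a : Fin n → ℕ) : Fin n → ℤ := fun j => a j

variable {a : Fin n → ℕ}

theorem dotProduct_toNat_eq {u : Fin n → ℤ} (hu : ∑ j, row a j * u j = 0) :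
    a ⬝ᵥ (fun j => (u j).toNat) = a ⬝ᵥ fun j => (-u j).toNat := by
  simp only [dotProduct]
  zify
  rw [← sub_eq_zero, ← Finset.sum_sub_distrib, ← hu]
  refine Finset.sum_congr rfl fun j _ => ?_
  rw [← mul_sub, Int.toNat_sub_toNat_neg]

theorem pdPow_sub_pdPow_mem_hypIdeal {u v : Fin n → ℕ} (h : a ⬝ᵥ u = a ⬝ᵥ v) (β : ℂ) :
    pdPow u - pdPow v ∈ hypIdeal (row a) β p := by
  have hu : u = u ⊓ v + fun j => ((u j : ℤ) - v j).toNat := by ext j; simp; omega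
  have hv : v = u ⊓ v + fun j => (-((u j : ℤ) - v j)).toNat := by ext j; simp; omega
  have hbox : (pdPow u - pdPow v : DStalk p) = pdPow (u ⊓ v) * box fun j => (u j : ℤ) - v j := by
    rw [box, mul_sub, ← pdPow_add, ← pdPow_add, ← hu, ← hv]
  rw [hbox]
  refine Submodule.smul_mem _ _ (Submodule.subset_span (Or.inl ⟨_, ?_, rfl⟩))
  simp only [mul_sub, Finset.sum_sub_distrib, sub_eq_zero]
  exact_mod_cast h

end Toric

section Action

open Polynomial

variable {n : ℕ} {p : Fin n → ℂ}

/-- The action of `𝒟` on `𝒪[X]` for which `∂ᵢ` acts as `∂/∂xᵢ + X ^ aᵢ`: the coefficientwise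
action, conjugated by `exp (∑ᵢ xᵢ X ^ aᵢ)`. It makes `P ↦ act a p P 1` the symbol map sending
`f ∂ᵘ` to `f X ^ (a ⬝ᵥ u)`. -/
def act (a : Fin n → ℕ) (p : Fin n → ℂ) : DStalk p →ₐ[ℂ] Module.End ℂ (HolGerm p)[X] :=
  DStalk.lift (fun f => LinearMap.mulLeft ℂ (C f))
    (fun i => LinearMap.mulLeft ℂ (X ^ a i) +
      (coeffDer (p := p) i : (HolGerm p)[X] →ₗ[ℂ] (HolGerm p)[X]))
    (fun f g => by ext1 h; simp [add_mul])
    (fun f g => by ext1 h; simp)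
    (fun c => by
      ext1 h
      rw [LinearMap.mulLeft_apply, Module.algebraMap_end_apply, ← algebraMap_eq_constGerm,
        ← Polynomial.algebraMap_apply, Algebra.smul_def])
    (fun i j => by
      ext1 h
      simp only [Module.End.mul_apply, LinearMap.add_apply, LinearMap.mulLeft_apply, map_add,
        Derivation.coeFn_coe, coeffDer_X_pow_mul, coeffDer_comm i j]
      ring)
    (fun i f => by
      ext1 h
      simp only [Module.End.mul_apply, LinearMap.add_apply, LinearMap.mulLeft_apply,
        Derivation.coeFn_coe, Derivation.leibniz, coeffDer_C, smul_eq_mul]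
      ring)

variable (a : Fin n → ℕ)

theorem act_fn (f : HolGerm p) (g : (HolGerm p)[X]) : act a p (fn f) g = C f * g :=
  LinearMap.congr_fun (DStalk.lift_mk _ _ _ _ _ _ _ (Sum.inl f)) g

theorem act_pd (i : Fin n) (g : (HolGerm p)[X]) :
    act a p (pd i) g = X ^ a i * g + coeffDer i g :=
  LinearMap.congr_fun (DStalk.lift_mk _ _ _ _ _ _ _ (Sum.inr i)) g

theorem act_mul (P Q : DStalk p) (g : (HolGerm p)[X]) :
    act a p (P * Q) g = act a p P (act a p Q g) := by
  rw [map_mul, Module.End.mul_apply]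

theorem act_algebraMap (c : ℂ) (g : (HolGerm p)[X]) :
    act a p (algebraMap ℂ _ c) g = c • g := by
  rw [AlgHom.commutes, Module.algebraMap_end_apply]

theorem act_X_pow_mul (P : DStalk p) (k : ℕ) (g : (HolGerm p)[X]) :
    act a p P (X ^ k * g) = X ^ k * act a p P g := by
  induction P using DStalk.induction generalizing g with
  | const c => simp only [act_algebraMap, mul_smul_comm]
  | fn f => rw [act_fn, act_fn, mul_left_comm]
  | pd i => rw [act_pd, act_pd, coeffDer_X_pow_mul]; ring
  | add P Q hP hQ => simp only [map_add, LinearMap.add_apply, hP, hQ, mul_add]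
  | mul P Q hP hQ => rw [act_mul, act_mul, hQ, hP]

theorem act_pdPow_X_pow (u : Fin n → ℕ) (k : ℕ) :
    act a p (pdPow u) (X ^ k) = X ^ (a ⬝ᵥ u + k) := by
  induction u using multiIndex_induction generalizing k with
  | zero => rw [pdPow_zero, map_one, Module.End.one_apply, dotProduct_zero, zero_add]
  | add u v hu hv => rw [pdPow_add, act_mul, hv, hu, dotProduct_add, add_assoc]
  | single i =>
    rw [pdPow_single_one, act_pd, coeffDer_X_pow, add_zero, dotProduct_single_one, pow_add]

theorem act_fn_mul_pdPow_one (f : HolGerm p) (u : Fin n → ℕ) :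
    act a p (fn f * pdPow u) 1 = C f * X ^ (a ⬝ᵥ u) := by
  rw [act_mul, act_fn, ← pow_zero X, act_pdPow_X_pow, add_zero]

theorem act_box_one {u : Fin n → ℤ} (hu : ∑ j, row a j * u j = 0) :
    act a p (box u) 1 = 0 := by
  rw [box, map_sub, LinearMap.sub_apply, ← pow_zero X, act_pdPow_X_pow, act_pdPow_X_pow,
    dotProduct_toNat_eq hu, sub_self]

variable {a} in
/-- Modulo the toric ideal, `P` is determined by its symbol `act a p P 1`: each power `X ^ l` in the
symbol is the image of a chosen monomial of weight `l`. -/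
theorem mem_hypIdeal_of_act_one_eq_zero {P : DStalk p} (hP : act a p P 1 = 0) (β : ℂ) :
    P ∈ hypIdeal (row a) β p := by
  let monomialOf : ℕ → Fin n → ℕ := Function.invFun (a ⬝ᵥ ·)
  let lift (g : (HolGerm p)[X]) : DStalk p := g.sum fun l f => fn f * pdPow (monomialOf l)
  have lift_zero : lift 0 = 0 := sum_zero_index _
  suffices h : P - lift (act a p P 1) ∈ hypIdeal (row a) β p by
    rwa [hP, lift_zero, sub_zero] at h
  clear hP
  have fn_zero : fn (0 : HolGerm p) = 0 := map_zero fnHom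
  induction P using DStalk.induction_normalForm with
  | zero => rw [map_zero, LinearMap.zero_apply, lift_zero, sub_zero]; exact zero_mem _
  | add P Q hP hQ =>
    have lift_add : lift (act a p P 1 + act a p Q 1) = lift (act a p P 1) + lift (act a p Q 1) :=
      sum_add_index _ _ _ (fun l => by rw [fn_zero, zero_mul]) fun l f g => by rw [fn_add, add_mul]
    rw [map_add, LinearMap.add_apply, lift_add, add_sub_add_comm]
    exact add_mem hP hQ
  | fn_mul_pdPow f u =>
    have lift_symbol : lift (C f * X ^ (a ⬝ᵥ u)) = fn f * pdPow (monomialOf (a ⬝ᵥ u)) := by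
      rw [C_mul_X_pow_eq_monomial]
      exact sum_monomial_index _ _ (by rw [fn_zero, zero_mul])
    rw [act_fn_mul_pdPow_one, lift_symbol, ← mul_sub]
    refine Submodule.smul_mem _ (fn f) (pdPow_sub_pdPow_mem_hypIdeal ?_ β)
    exact (Function.invFun_eq (f := (a ⬝ᵥ ·)) ⟨u, rfl⟩).symm

end Action

section Euler

open Polynomial

variable {n : ℕ} {p : Fin n → ℂ} (a : Fin n → ℕ)

/-- The symbol `∑ⱼ aⱼ xⱼ X ^ aⱼ` of the vector field `∑ⱼ aⱼ xⱼ ∂ⱼ`. -/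
def eulerPoly : (HolGerm p)[X] :=
  ∑ j, a j • (C (coord j) * X ^ a j)

theorem coeffDer_eulerPoly (i : Fin n) :
    coeffDer i (eulerPoly a : (HolGerm p)[X]) = a i • X ^ a i := by
  have hterm : ∀ j, coeffDer i (C (coord j : HolGerm p) * X ^ a j) =
      if i = j then X ^ a j else 0 := by
    intro j
    rw [Derivation.leibniz, coeffDer_X_pow, smul_zero, zero_add, coeffDer_C, partialGerm_coord]
    split_ifs <;> simp
  simp only [eulerPoly, map_sum, map_nsmul, hterm, smul_ite, smul_zero, Finset.sum_ite_eq,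
    Finset.mem_univ, if_true]

/-- The endomorphism `g ↦ (∑ⱼ aⱼ xⱼ X ^ aⱼ) g + X g' - β g` of `𝒪[X]`, which corresponds under
`P ↦ act a p P 1` to the right multiplication by the Euler operator `E_A(β)`. -/
def eulerEnd (β : ℂ) (p : Fin n → ℂ) : Module.End ℂ (HolGerm p)[X] :=
  LinearMap.mulLeft ℂ (eulerPoly a) +
    LinearMap.mulLeft ℂ X ∘ₗ (derivative : (HolGerm p)[X] →ₗ[HolGerm p] _).restrictScalars ℂ -
    algebraMap ℂ _ β

theorem eulerEnd_apply (β : ℂ) (g : (HolGerm p)[X]) :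
    eulerEnd a β p g = eulerPoly a * g + X * derivative g - β • g := by
  simp only [eulerEnd, LinearMap.sub_apply, LinearMap.add_apply, LinearMap.mulLeft_apply,
    LinearMap.comp_apply, LinearMap.restrictScalars_apply, Module.algebraMap_end_apply]

theorem X_mul_derivative_X_pow_mul (k : ℕ) (g : (HolGerm p)[X]) :
    X * derivative (X ^ k * g) = X ^ k * (X * derivative g + (k : ℂ) • g) := by
  rw [derivative_mul, derivative_X_pow, Nat.cast_smul_eq_nsmul, nsmul_eq_mul, C_eq_natCast]
  cases k with
  | zero => simp
  | succ k => rw [Nat.add_sub_cancel, pow_succ]; ring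

theorem eulerEnd_X_pow_mul (β : ℂ) (k : ℕ) (g : (HolGerm p)[X]) :
    eulerEnd a β p (X ^ k * g) = X ^ k * eulerEnd a (β - k) p g := by
  rw [eulerEnd_apply, eulerEnd_apply, X_mul_derivative_X_pow_mul, sub_smul, ← mul_smul_comm]
  ring

theorem coeff_eulerEnd (β : ℂ) (g : (HolGerm p)[X]) (l : ℕ) :
    (eulerEnd a β p g).coeff l =
      ∑ j, a j • (coord j * if a j ≤ l then g.coeff (l - a j) else 0) +
        ((l : ℂ) - β) • g.coeff l := by
  have hderiv : (X * derivative g).coeff l = (l : ℂ) • g.coeff l := by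
    cases l with
    | zero => simp
    | succ l =>
      rw [coeff_X_mul, coeff_derivative, Nat.cast_smul_eq_nsmul, nsmul_eq_mul, mul_comm]
      push_cast; rfl
  simp only [eulerEnd_apply, eulerPoly, Finset.sum_mul, coeff_sub, coeff_add, finsetSum_coeff,
    smul_mul_assoc, coeff_smul, mul_assoc, coeff_C_mul, coeff_X_pow_mul', hderiv, sub_smul,
    add_sub_assoc]

theorem eulerEnd_act (β : ℂ) (P : DStalk p) (g : (HolGerm p)[X]) :
    eulerEnd a β p (act a p P g) = act a p P (eulerEnd a β p g) := by
  induction P using DStalk.induction generalizing g with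
  | const c => simp only [act_algebraMap, map_smul]
  | fn f =>
    rw [act_fn, act_fn, eulerEnd_apply, eulerEnd_apply, derivative_C_mul, ← mul_smul_comm]
    ring
  | pd i =>
    have hX : coeffDer i (X * derivative g) = X * derivative (coeffDer i g) := by
      simpa only [pow_one, coeffDer_derivative] using coeffDer_X_pow_mul i 1 (derivative g)
    rw [act_pd, act_pd, map_add, eulerEnd_X_pow_mul, eulerEnd_apply, eulerEnd_apply,
      eulerEnd_apply, map_sub, map_add, Derivation.map_smul, hX, Derivation.leibniz,
      coeffDer_eulerPoly, sub_smul, Nat.cast_smul_eq_nsmul]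
    simp only [smul_eq_mul, nsmul_eq_mul]
    ring
  | add P Q hP hQ => simp only [map_add, LinearMap.add_apply, hP, hQ]
  | mul P Q hP hQ => rw [act_mul, act_mul, hP, hQ]

theorem act_euler_one (β : ℂ) : act a p (euler (row a) β) 1 = eulerEnd a β p 1 := by
  have hterm : ∀ j, act a p ((row a j : ℂ) • (fn (coord j) * pd j)) 1 =
      a j • (C (coord j) * X ^ a j) := by
    intro j
    rw [map_smul, LinearMap.smul_apply, ← pdPow_single_one, act_fn_mul_pdPow_one,
      dotProduct_single_one, Int.cast_natCast, Nat.cast_smul_eq_nsmul]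
  rw [euler, map_sub, map_sum, LinearMap.sub_apply, LinearMap.sum_apply, act_algebraMap,
    eulerEnd_apply, eulerPoly, derivative_one, mul_zero, add_zero, mul_one]
  simp only [hterm]

theorem act_mul_euler_one (P : DStalk p) (β : ℂ) :
    act a p (P * euler (row a) β) 1 = eulerEnd a β p (act a p P 1) := by
  rw [act_mul, act_euler_one, eulerEnd_act]

theorem act_hypIdeal_one {β : ℂ} {P : DStalk p} (hP : P ∈ hypIdeal (row a) β p) :
    act a p P 1 ∈ LinearMap.range (eulerEnd a β p) := by
  induction hP using Submodule.span_induction with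
  | mem x hx =>
    rcases hx with ⟨u, hu, rfl⟩ | rfl
    · rw [act_box_one a hu]; exact zero_mem _
    · exact ⟨1, (act_euler_one a β).symm⟩
  | zero => rw [map_zero]; exact zero_mem _
  | add x y _ _ hx hy => rw [map_add]; exact add_mem hx hy
  | smul Q x _ hx =>
    obtain ⟨g, hg⟩ := hx
    exact ⟨act a p Q g, by rw [smul_eq_mul, act_mul, ← hg, eulerEnd_act]⟩

end Euler

section Support

open Polynomial

variable {n : ℕ} {p : Fin n → ℂ} {a : Fin n → ℕ}

/-- The translate by `c` of the numerical semigroup generated by the weights `a`. -/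
def translate (a : Fin n → ℕ) (c : ℕ) : Set ℕ :=
  Set.range fun u : Fin n → ℕ => c + a ⬝ᵥ u

theorem add_mem_translate {c l : ℕ} (hl : l ∈ translate a c) (j : Fin n) :
    l + a j ∈ translate a c := by
  obtain ⟨u, rfl⟩ := hl
  refine ⟨u + Pi.single j 1, ?_⟩
  simp only [dotProduct_add, dotProduct_single_one, add_assoc]

theorem coeff_X_pow_mul_act_one_eq_zero (c : ℕ) (P : DStalk p) :
    ∀ l ∉ translate a c, (X ^ c * act a p P 1).coeff l = 0 := by
  induction P using DStalk.induction_normalForm with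
  | zero => simp
  | add P Q hP hQ =>
    intro l hl
    rw [map_add, LinearMap.add_apply, mul_add, coeff_add, hP l hl, hQ l hl, add_zero]
  | fn_mul_pdPow f u =>
    intro l hl
    rw [act_fn_mul_pdPow_one, mul_left_comm, ← pow_add, coeff_C_mul_X_pow]
    exact if_neg fun h => hl ⟨u, h.symm⟩

theorem coeff_eq_zero_of_coeff_eulerEnd_eq_zero (ha : ∀ j, 0 < a j) {T : Set ℕ}
    (hT : ∀ l ∈ T, ∀ j, l + a j ∈ T) {β : ℂ} (hβ : ∀ l : ℕ, β = l → l ∈ T) {g : (HolGerm p)[X]}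
    (hg : ∀ l ∉ T, (eulerEnd a β p g).coeff l = 0) : ∀ l ∉ T, g.coeff l = 0 := by
  intro l hl
  induction l using Nat.strong_induction_on with
  | _ l ih =>
    have hlower : ∀ j, (if a j ≤ l then g.coeff (l - a j) else 0) = 0 := by
      intro j
      split_ifs with hj
      · have hlj : l - a j + a j = l := Nat.sub_add_cancel hj
        refine ih _ (Nat.sub_lt ((ha j).trans_le hj) (ha j)) fun hmem => hl ?_
        exact hlj ▸ hT _ hmem j
      · rfl
    have hcoeff := hg l hl
    simp only [coeff_eulerEnd, hlower, mul_zero, smul_zero, Finset.sum_const_zero,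
      zero_add] at hcoeff
    have hlβ : IsUnit ((l : ℂ) - β) := (sub_ne_zero.2 fun h => hl (hβ l h.symm)).isUnit
    exact hlβ.smul_eq_zero.1 hcoeff

variable {ι : Type*} [Fintype ι] {c : ι → ℕ}

theorem exists_eq_sum_X_pow_mul_act_one {g : (HolGerm p)[X]}
    (hg : ∀ l ∉ ⋃ i, translate a (c i), g.coeff l = 0) :
    ∃ G : ι → DStalk p, g = ∑ i, X ^ c i * act a p (G i) 1 := by
  rw [as_sum_support_C_mul_X_pow g]
  refine Finset.sum_induction _ (fun g => ∃ G : ι → DStalk p, g = ∑ i, X ^ c i * act a p (G i) 1)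
    ?_ ⟨0, by simp⟩ fun l hl => ?_
  · rintro _ _ ⟨G, rfl⟩ ⟨H, rfl⟩
    refine ⟨G + H, ?_⟩
    simp only [Pi.add_apply, map_add, LinearMap.add_apply, mul_add, Finset.sum_add_distrib]
  · classical
    have hlT : l ∈ ⋃ i, translate a (c i) := by_contra fun h => mem_support_iff.1 hl (hg l h)
    obtain ⟨i, u, rfl⟩ := Set.mem_iUnion.1 hlT
    refine ⟨Pi.single i (fn (g.coeff (c i + a ⬝ᵥ u)) * pdPow u), ?_⟩
    rw [Fintype.sum_eq_single i fun j hj => by rw [Pi.single_eq_of_ne hj]; simp,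
      Pi.single_eq_same, act_fn_mul_pdPow_one, mul_left_comm, ← pow_add]

theorem act_one_eq_zero_of_sum_eq_zero (hc : Pairwise (Function.onFun Disjoint
    fun i => translate a (c i))) {P : ι → DStalk p} (h : ∑ i, X ^ c i * act a p (P i) 1 = 0)
    (i : ι) : act a p (P i) 1 = 0 := by
  have hcoeff : X ^ c i * act a p (P i) 1 = 0 := by
    ext1 l
    by_cases hl : l ∈ translate a (c i)
    · have hother : ∀ j ≠ i, (X ^ c j * act a p (P j) 1).coeff l = 0 := fun j hj =>
        coeff_X_pow_mul_act_one_eq_zero _ _ _ fun hlj => (hc hj).le_bot ⟨hlj, hl⟩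
      rw [← Fintype.sum_eq_single i hother, ← finsetSum_coeff, h]
    · exact coeff_X_pow_mul_act_one_eq_zero _ _ l hl
  exact (isRegular_X_pow (c i)).left (hcoeff.trans (mul_zero _).symm)

theorem mem_hypIdeal_of_sum_mem_range_eulerEnd (ha : ∀ j, 0 < a j)
    (hc : Pairwise (Function.onFun Disjoint fun i => translate a (c i))) {β : ℂ}
    (hβ : ∀ l : ℕ, β = l → l ∈ ⋃ i, translate a (c i)) {P : ι → DStalk p}
    (hP : ∑ i, X ^ c i * act a p (P i) 1 ∈ LinearMap.range (eulerEnd a β p)) (i : ι) :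
    P i ∈ hypIdeal (row a) (β - c i) p := by
  obtain ⟨g, hg⟩ := hP
  have hsupport : ∀ l ∉ ⋃ i, translate a (c i), g.coeff l = 0 := by
    refine coeff_eq_zero_of_coeff_eulerEnd_eq_zero ha (fun l hl j => ?_) hβ fun l hl => ?_
    · obtain ⟨i, hi⟩ := Set.mem_iUnion.1 hl
      exact Set.mem_iUnion.2 ⟨i, add_mem_translate hi j⟩
    · rw [hg, finsetSum_coeff]
      exact Finset.sum_eq_zero fun i _ => coeff_X_pow_mul_act_one_eq_zero _ _ _ fun hi =>
        hl (Set.mem_iUnion.2 ⟨i, hi⟩)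
  obtain ⟨G, rfl⟩ := exists_eq_sum_X_pow_mul_act_one hsupport
  have hzero : ∑ i, X ^ c i * act a p (P i - G i * euler (row a) (β - c i)) 1 = 0 := by
    simp only [map_sub, LinearMap.sub_apply, mul_sub, Finset.sum_sub_distrib, ← hg, map_sum,
      act_mul_euler_one, eulerEnd_X_pow_mul, sub_self]
  rw [← sub_add_cancel (P i) (G i * euler (row a) (β - c i))]
  exact add_mem (mem_hypIdeal_of_act_one_eq_zero (act_one_eq_zero_of_sum_eq_zero hc hzero i) _)
    (Submodule.smul_mem _ _ (Submodule.subset_span (Or.inr rfl)))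

end Support

section Stalks

open Polynomial

variable {m r : ℕ} {p : Fin r → ℂ}

/-- The coefficientwise restriction `𝒪[X] → 𝒪'[X]` to the subspace `x₁ = ⋯ = xₘ = 0`. -/
def restrPoly (m : ℕ) {r : ℕ} (p : Fin r → ℂ) :
    (HolGerm (incl m p))[X] →ₐ[ℂ] (HolGerm p)[X] :=
  mapAlgHom (restr m p)

theorem restrPoly_C (f : HolGerm (incl m p)) : restrPoly m p (C f) = C (restr m p f) :=
  map_C _

theorem restrPoly_X : restrPoly m p X = X :=
  map_X _

theorem restrPoly_coeffDer (j : Fin r) (g : (HolGerm (incl m p))[X]) :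
    restrPoly m p (coeffDer (Fin.natAdd m j) g) = coeffDer j (restrPoly m p g) := by
  ext1 l
  rw [restrPoly, coe_mapAlgHom, coeff_map, coeff_coeffDer, coeff_coeffDer, coeff_map]
  exact restr_partialGerm j _

theorem restrPoly_derivative (g : (HolGerm (incl m p))[X]) :
    restrPoly m p (derivative g) = derivative (restrPoly m p g) :=
  (derivative_map g _).symm

variable (a : Fin (m + r) → ℕ)

theorem restrPoly_act_extOp (Q : DStalk p) (g : (HolGerm (incl m p))[X]) :
    restrPoly m p (act a _ (extOp m p Q) g) = act (a ∘ Fin.natAdd m) p Q (restrPoly m p g) := by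
  induction Q using DStalk.induction generalizing g with
  | const c => rw [AlgHom.commutes, act_algebraMap, act_algebraMap, map_smul]
  | fn f => rw [extOp_fn, act_fn, act_fn, map_mul, restrPoly_C, restr_pull]
  | pd j =>
    rw [extOp_pd, act_pd, act_pd, map_add, map_mul, map_pow, restrPoly_X, restrPoly_coeffDer,
      Function.comp_apply]
  | add P Q hP hQ => simp only [map_add, LinearMap.add_apply, hP, hQ]
  | mul P Q hP hQ => rw [map_mul, act_mul, act_mul, hP, hQ]

theorem restrPoly_eulerPoly :
    restrPoly m p (eulerPoly a) = eulerPoly (a ∘ Fin.natAdd m) := by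
  simp only [eulerPoly, Fin.sum_univ_add, map_add, map_sum, map_nsmul, map_mul, map_pow,
    restrPoly_C, restrPoly_X, restr_coord_castAdd, restr_coord_natAdd, map_zero, zero_mul,
    smul_zero, Finset.sum_const_zero, zero_add, Function.comp_apply]

theorem restrPoly_eulerEnd (β : ℂ) (g : (HolGerm (incl m p))[X]) :
    restrPoly m p (eulerEnd a β _ g) = eulerEnd (a ∘ Fin.natAdd m) β p (restrPoly m p g) := by
  rw [eulerEnd_apply, eulerEnd_apply, map_sub, map_add, map_mul, map_mul, map_smul,
    restrPoly_eulerPoly, restrPoly_X, restrPoly_derivative]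

variable {a} in
theorem restrPoly_act_one_mem_range_eulerEnd {β : ℂ} {P : DStalk (incl m p)}
    (hP : P ∈ restrSub (row a) β p) :
    restrPoly m p (act a _ P 1) ∈ LinearMap.range (eulerEnd (a ∘ Fin.natAdd m) β p) := by
  obtain ⟨H, hH, K, rfl⟩ := hP
  obtain ⟨g, hg⟩ := act_hypIdeal_one a hH
  refine ⟨restrPoly m p g, ?_⟩
  simp only [map_add, map_sum, LinearMap.add_apply, LinearMap.sum_apply, act_mul, act_fn,
    map_mul (restrPoly m p), restrPoly_C, restr_coord_castAdd, map_zero, zero_mul,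
    Finset.sum_const_zero, add_zero]
  rw [← hg, restrPoly_eulerEnd]

section Classes

variable (A : Fin (m + r) → ℤ) (β : ℂ)

theorem smul_rStalkMk (Q : DStalk p) (P : DStalk (incl m p)) :
    Q • RStalk.mk A β p P = RStalk.mk A β p (extOp m p Q * P) := rfl

theorem sum_smul_rStalkMk {ι : Type*} [Fintype ι] (Q : ι → DStalk p) (P : ι → DStalk (incl m p)) :
    ∑ i, Q i • RStalk.mk A β p (P i) = RStalk.mk A β p (∑ i, extOp m p (Q i) * P i) :=
  (map_sum (restrSub A β p).mkQ (fun i => extOp m p (Q i) * P i) _).symm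

variable {A β}

theorem rStalkMk_eq_zero {P : DStalk (incl m p)} :
    RStalk.mk A β p P = 0 ↔ P ∈ restrSub A β p :=
  Submodule.Quotient.mk_eq_zero _

theorem rStalkMk_eq_rStalkMk {P Q : DStalk (incl m p)} (H : DStalk (incl m p))
    (hH : H ∈ hypIdeal A β (incl m p)) (K : Fin m → DStalk (incl m p))
    (h : P - Q = H + ∑ i, fn (coord (Fin.castAdd r i)) * K i) :
    RStalk.mk A β p P = RStalk.mk A β p Q :=
  (Submodule.Quotient.eq _).2 ⟨H, hH, K, h⟩

theorem rStalkMk_eq_of_sub_mem_hypIdeal {P Q : DStalk (incl m p)}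
    (h : P - Q ∈ hypIdeal A β (incl m p)) : RStalk.mk A β p P = RStalk.mk A β p Q :=
  rStalkMk_eq_rStalkMk _ h 0 (by simp)

theorem rStalkMk_fn_mul (φ : HolGerm (incl m p)) (W : DStalk (incl m p)) :
    RStalk.mk A β p (fn φ * W) = fn (restr m p φ) • RStalk.mk A β p W := by
  obtain ⟨K, hK⟩ := exists_eq_pull_restr_add φ
  rw [smul_rStalkMk, extOp_fn]
  refine rStalkMk_eq_rStalkMk 0 (zero_mem _) (fun i => fn (K i) * W) ?_
  have hfn : fn φ = fn (pull m (restr m p φ)) +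
      ∑ i, fn (coord (Fin.castAdd r i)) * fn (K i) := by
    conv_lhs => rw [hK]
    simp only [← fnHom_apply, map_add, map_sum, map_mul]
  simp only [hfn, add_mul, Finset.sum_mul, mul_assoc, add_sub_cancel_left, zero_add]

end Classes

theorem euler_eq_add_extOp (A : Fin (m + r) → ℤ) (γ : ℂ) :
    euler A γ = ∑ i, fn (coord (Fin.castAdd r i)) * ((A (Fin.castAdd r i) : ℂ) •
      pd (Fin.castAdd r i)) + extOp m p (euler (A ∘ Fin.natAdd m) γ) := by
  have hext : ∀ j, extOp m p (fn (coord j) * pd j) =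
      fn (coord (Fin.natAdd m j)) * pd (Fin.natAdd m j) := fun j => by
    rw [map_mul, extOp_fn, extOp_pd]; rfl
  simp only [euler, Fin.sum_univ_add, map_sub, map_sum, map_smul, AlgHom.commutes, hext,
    mul_smul_comm, Function.comp_apply, add_sub_assoc]

/-- The class of `∂_{i₀} ^ l` in the stalk of the restriction. When `i₀` has weight one, it is the
class of all the monomials of weight `l`. -/
def powClass (a : Fin (m + r) → ℕ) (i₀ : Fin (m + r)) (β : ℂ) (l : ℕ) (p : Fin r → ℂ) :
    RStalk (row a) β p :=
  RStalk.mk (row a) β p (pd i₀ ^ l)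

variable {a} {i₀ : Fin (m + r)}

theorem rStalkMk_pdPow (ha₀ : a i₀ = 1) (β : ℂ) (u : Fin (m + r) → ℕ) :
    RStalk.mk (row a) β p (pdPow u) = powClass a i₀ β (a ⬝ᵥ u) p := by
  rw [powClass, ← pdPow_single]
  refine rStalkMk_eq_of_sub_mem_hypIdeal (pdPow_sub_pdPow_mem_hypIdeal ?_ β)
  rw [dotProduct_single, ha₀, one_mul]

theorem extOp_pdPow (u : Fin r → ℕ) : extOp m p (pdPow u) = pdPow (Fin.append 0 u) := by
  induction u using multiIndex_induction with
  | zero =>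
    rw [pdPow_zero, map_one, ← pdPow_zero]
    congr 1
    ext i
    cases i using Fin.addCases <;> simp
  | add u v hu hv =>
    rw [pdPow_add, map_mul, hu, hv, ← pdPow_add]
    congr 1
    ext i
    cases i using Fin.addCases <;> simp
  | single j =>
    rw [pdPow_single_one, extOp_pd, ← pdPow_single_one]
    congr 1
    ext i
    cases i using Fin.addCases <;>
      simp [Pi.single_apply, castAdd_ne_natAdd]

theorem pdPow_smul_powClass (ha₀ : a i₀ = 1) (β : ℂ) (u : Fin r → ℕ) (l : ℕ) :
    (pdPow u : DStalk p) • powClass a i₀ β l p =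
      powClass a i₀ β (l + (a ∘ Fin.natAdd m) ⬝ᵥ u) p := by
  rw [powClass, smul_rStalkMk, extOp_pdPow, ← pdPow_single, ← pdPow_add, rStalkMk_pdPow ha₀,
    dotProduct_add, dotProduct_single, ha₀, one_mul]
  congr 1
  simp [dotProduct, Fin.sum_univ_add, add_comm]

theorem euler_smul_powClass (ha₀ : a i₀ = 1) (β : ℂ) (l : ℕ) :
    (euler (row (a ∘ Fin.natAdd m)) (β - l) : DStalk p) • powClass a i₀ β l p = 0 := by
  have hcomm : (pd i₀ ^ l * euler (row a) β : DStalk (incl m p)) =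
      euler (row a) (β - l) * pd i₀ ^ l := by
    rw [← pdPow_single, pdPow_mul_euler]
    simp [Pi.single_apply, ha₀]
  rw [powClass, smul_rStalkMk, rStalkMk_eq_zero]
  refine ⟨pd i₀ ^ l * euler (row a) β, Submodule.smul_mem _ _ (Submodule.subset_span (Or.inr rfl)),
    fun i => -((row a (Fin.castAdd r i) : ℂ) • pd (Fin.castAdd r i) * pd i₀ ^ l), ?_⟩
  rw [hcomm, euler_eq_add_extOp (row a)]
  simp only [mul_neg, Finset.sum_neg_distrib, ← mul_assoc, ← Finset.sum_mul, add_mul,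
    add_neg_cancel_comm]
  rfl

theorem smul_powClass_eq_zero (ha₀ : a i₀ = 1) {β : ℂ} {l : ℕ} {P : DStalk p}
    (hP : P ∈ hypIdeal (row (a ∘ Fin.natAdd m)) (β - l) p) : P • powClass a i₀ β l p = 0 := by
  suffices h : hypIdeal (row (a ∘ Fin.natAdd m)) (β - l) p ≤
      LinearMap.ker (LinearMap.toSpanSingleton (DStalk p) _ (powClass a i₀ β l p)) from h hP
  refine Submodule.span_le.2 ?_
  rintro _ (⟨u, hu, rfl⟩ | rfl)
  · change (box u : DStalk p) • powClass a i₀ β l p = 0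
    rw [box, sub_smul, pdPow_smul_powClass ha₀, pdPow_smul_powClass ha₀, dotProduct_toNat_eq hu,
      sub_self]
  · exact euler_smul_powClass ha₀ β l

theorem sum_smul_powClass_eq_zero_iff {ι : Type*} [Fintype ι] {c : ι → ℕ} (ha₀ : a i₀ = 1)
    (ha : ∀ j, 0 < (a ∘ Fin.natAdd m) j)
    (hc : Pairwise (Function.onFun Disjoint fun i => translate (a ∘ Fin.natAdd m) (c i))) {β : ℂ}
    (hβ : ∀ l : ℕ, β = l → l ∈ ⋃ i, translate (a ∘ Fin.natAdd m) (c i)) (P : ι → DStalk p) :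
    ∑ i, P i • powClass a i₀ β (c i) p = 0 ↔
      ∀ i, P i ∈ hypIdeal (row (a ∘ Fin.natAdd m)) (β - c i) p := by
  refine ⟨fun h => ?_, fun h => Finset.sum_eq_zero fun i _ => smul_powClass_eq_zero ha₀ (h i)⟩
  have hsymbol : ∀ i, restrPoly m p (act a _ (extOp m p (P i) * pd i₀ ^ c i) 1) =
      X ^ c i * act (a ∘ Fin.natAdd m) p (P i) 1 := by
    intro i
    rw [act_mul, restrPoly_act_extOp, ← pdPow_single, ← pow_zero X, act_pdPow_X_pow, map_pow,
      restrPoly_X, add_zero, dotProduct_single, ha₀, one_mul, ← act_X_pow_mul, mul_one]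
  simp only [powClass, sum_smul_rStalkMk, rStalkMk_eq_zero] at h
  have hrange := restrPoly_act_one_mem_range_eulerEnd h
  simp only [map_sum, LinearMap.sum_apply, hsymbol] at hrange
  exact mem_hypIdeal_of_sum_mem_range_eulerEnd ha hc hβ hrange

end Stalks

section Sections

variable {n : ℕ} {V : Opens (Fin n → ℂ)}

theorem fn_mem_DPre {f : (Fin n → ℂ) → ℂ} (hf : ∀ q : V, AnalyticAt ℂ f q.1) :
    (fun q : V => fn (germ f (hf q))) ∈ DPre V :=
  Algebra.subset_adjoin (Or.inl ⟨f, hf, rfl⟩)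

theorem pd_mem_DPre (i : Fin n) : (fun q : V => (pd i : DStalk q.1)) ∈ DPre V :=
  Algebra.subset_adjoin (Or.inr ⟨i, rfl⟩)

theorem pdPow_mem_DPre (u : Fin n → ℕ) : (fun q : V => (pdPow u : DStalk q.1)) ∈ DPre V := by
  induction u using multiIndex_induction with
  | zero =>
    simp only [pdPow_zero]
    exact one_mem _
  | add u v hu hv =>
    simp only [pdPow_add]
    exact mul_mem hu hv
  | single j => simpa only [pdPow_single_one] using pd_mem_DPre j

theorem exists_mem_DPre_apply_eq {p : Fin n → ℂ} (P : DStalk p) :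
    ∃ (V : Opens (Fin n → ℂ)) (hp : p ∈ V), ∃ Q ∈ DPre V, Q ⟨p, hp⟩ = P := by
  induction P using DStalk.induction_normalForm with
  | zero => exact ⟨⊤, trivial, 0, zero_mem _, rfl⟩
  | add P P' hP hP' =>
    obtain ⟨V, hpV, Q, hQ, rfl⟩ := hP
    obtain ⟨V', hpV', Q', hQ', rfl⟩ := hP'
    exact ⟨V ⊓ V', ⟨hpV, hpV'⟩, _,
      add_mem (resFun_mem_DPre inf_le_left hQ) (resFun_mem_DPre inf_le_right hQ'), rfl⟩
  | fn_mul_pdPow φ u =>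
    obtain ⟨f, hf, rfl⟩ := exists_eq_germ φ
    exact ⟨⟨{x | AnalyticAt ℂ f x}, isOpen_analyticAt ℂ f⟩, hf, _,
      mul_mem (fn_mem_DPre fun q => q.2) (pdPow_mem_DPre u), rfl⟩

variable {m r k : ℕ} {A : Fin (m + r) → ℤ} {β : ℂ} {A' : Fin r → ℤ} {b : Fin k → ℂ}

theorem mem_RSec_of_locally {U : Opens (Fin r → ℂ)} {s : ∀ q : U, RStalk A β q.1}
    (hs : ∀ p : U, ∃ (V : Opens (Fin r → ℂ)) (h : V ≤ U), p.1 ∈ V ∧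
      resFun (F := RStalk A β) h s ∈ RSec A β V) : s ∈ RSec A β U := by
  intro p
  obtain ⟨V, hV, hpV, hsV⟩ := hs p
  obtain ⟨W, hpW, P, hP, hsP⟩ := hsV ⟨p.1, hpV⟩
  have mem_cyl : ∀ q : Fin r → ℂ, incl m q ∈ cyl m V ↔ q ∈ V := fun q => by
    change projL m r (incl m q) ∈ V ↔ q ∈ V
    rw [projL_incl]
  exact ⟨W ⊓ cyl m V, ⟨hpW, (mem_cyl _).2 hpV⟩, _, resFun_mem_DSec inf_le_left hP,
    fun q hq => hsP ⟨q.1, (mem_cyl _).1 hq.2⟩ hq.1⟩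

theorem restrictionIso_of_stalkEquiv
    (e : ∀ p, RStalk A β p ≃ₗ[DStalk p] (∀ i, MStalk A' (b i) p))
    (he : ∀ (U : Opens (Fin r → ℂ)) (s : ∀ q : U, RStalk A β q.1),
      s ∈ RSec A β U ↔ ∀ i, (fun q : U => e q.1 (s q) i) ∈ MSec A' (b i) U) :
    RestrictionIso A β A' b := by
  refine ⟨fun U =>
    { toFun s i := ⟨fun q => e q.1 (s.1 q) i, (he U s.1).1 s.2 i⟩
      invFun t := ⟨fun q => (e q.1).symm fun i => (t i).1 q, (he U _).2 fun i => by
        simpa only [LinearEquiv.apply_symm_apply] using (t i).2⟩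
      map_add' s t := ?_
      map_smul' P s := ?_
      left_inv s := ?_
      right_inv t := ?_ }, fun U V h s i => rfl⟩
  · ext i q
    exact congrFun (map_add (e q.1) (s.1 q) (t.1 q)) i
  · ext i q
    exact congrFun (map_smul (e q.1) (P.1 q) (s.1 q)) i
  · ext q
    exact (e q.1).symm_apply_apply _
  · ext i q
    exact congrFun ((e q.1).apply_symm_apply _) i

variable (A β A' b) in
/-- A presentation of the restriction of `ℳ_A(β)` to `x₁ = ⋯ = xₘ = 0` as a direct sum of
hypergeometric systems: global generators, which generate locally over `𝒟'`, and whose module of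
relations at each point is the direct sum of the ideals `H_{A'}(bᵢ)`. -/
structure Presentation where
  gen : Fin k → ∀ p, RStalk A β p
  gen_mem_RSec : ∀ (i : Fin k) (U : Opens (Fin r → ℂ)), (fun q : U => gen i q.1) ∈ RSec A β U
  sum_smul_gen_eq_zero_iff : ∀ {p : Fin r → ℂ} (P : Fin k → DStalk p),
    ∑ i, P i • gen i p = 0 ↔ ∀ i, P i ∈ hypIdeal A' (b i) p
  exists_eq_sum_smul_gen : ∀ {U : Opens (Fin r → ℂ)} {s : ∀ q : U, RStalk A β q.1},
    s ∈ RSec A β U → ∀ p : U, ∃ (V : Opens (Fin r → ℂ)) (h : V ≤ U), p.1 ∈ V ∧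
      ∃ Q : Fin k → DPre V, ∀ q : V, s ⟨q.1, h q.2⟩ = ∑ i, (Q i).1 q • gen i q.1

namespace Presentation

variable {p : Fin r → ℂ} (F : Presentation A β A' b)

theorem smul_gen_eq_zero (i : Fin k) {P : DStalk p} (hP : P ∈ hypIdeal A' (b i) p) :
    P • F.gen i p = 0 := by
  have h := (F.sum_smul_gen_eq_zero_iff (Pi.single i P)).2 fun j => by
    obtain rfl | hj := eq_or_ne j i
    · rwa [Pi.single_eq_same]
    · rw [Pi.single_eq_of_ne hj]
      exact zero_mem _
  rwa [Fintype.sum_eq_single i fun j hj => by rw [Pi.single_eq_of_ne hj, zero_smul],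
    Pi.single_eq_same] at h

/-- The map from the stalk of `ℳ_{A'}(bᵢ)` to that of the restriction sending `1` to the `i`-th
generator. -/
def stalkMap (i : Fin k) (p : Fin r → ℂ) : MStalk A' (b i) p →ₗ[DStalk p] RStalk A β p :=
  (hypIdeal A' (b i) p).liftQ (LinearMap.toSpanSingleton _ _ (F.gen i p))
    fun _ hP => F.smul_gen_eq_zero i hP

theorem stalkMap_mkQ (i : Fin k) (P : DStalk p) :
    F.stalkMap i p ((hypIdeal A' (b i) p).mkQ P) = P • F.gen i p := rfl

/-- The map from the stalk of `⨁ᵢ ℳ_{A'}(bᵢ)` to that of the restriction given by the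
generators. -/
def sumMap (p : Fin r → ℂ) : (∀ i, MStalk A' (b i) p) →ₗ[DStalk p] RStalk A β p :=
  ∑ i, F.stalkMap i p ∘ₗ LinearMap.proj i

theorem sumMap_apply (t : ∀ i, MStalk A' (b i) p) :
    F.sumMap p t = ∑ i, F.stalkMap i p (t i) := by
  simp only [sumMap, LinearMap.sum_apply, LinearMap.comp_apply, LinearMap.proj_apply]

theorem sumMap_injective (p : Fin r → ℂ) : Function.Injective (F.sumMap p) := by
  refine (injective_iff_map_eq_zero _).2 fun t ht => funext fun i => ?_
  choose P hP using fun i => (hypIdeal A' (b i) p).mkQ_surjective (t i)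
  simp only [sumMap_apply, ← hP, stalkMap_mkQ, F.sum_smul_gen_eq_zero_iff] at ht
  rw [← hP]
  exact (Submodule.Quotient.mk_eq_zero _).2 (ht i)

theorem mk_mem_RSec {V : Opens (Fin (m + r) → ℂ)} {P : ∀ q : V, DStalk q.1} (hP : P ∈ DPre V) :
    (fun q : slice (m := m) V => RStalk.mk A β q.1 (P ⟨incl m q.1, q.2⟩)) ∈
      RSec A β (slice (m := m) V) :=
  fun p => ⟨V, p.2, P, mem_DSec_of_mem_DPre hP, fun _ _ => rfl⟩

theorem sumMap_surjective (p : Fin r → ℂ) : Function.Surjective (F.sumMap p) := by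
  intro x
  obtain ⟨P, rfl⟩ := (restrSub A β p).mkQ_surjective x
  obtain ⟨V, hpV, P, hP, rfl⟩ := exists_mem_DPre_apply_eq (p := incl m p) P
  obtain ⟨W, _, hpW, Q, hQ⟩ := F.exists_eq_sum_smul_gen (mk_mem_RSec hP) ⟨p, hpV⟩
  refine ⟨fun i => (hypIdeal A' (b i) p).mkQ ((Q i).1 ⟨p, hpW⟩), ?_⟩
  simp only [sumMap_apply, stalkMap_mkQ]
  exact (hQ ⟨p, hpW⟩).symm

/-- The isomorphism between the stalks of the restriction and of the direct sum. -/
def stalkEquiv (p : Fin r → ℂ) : RStalk A β p ≃ₗ[DStalk p] (∀ i, MStalk A' (b i) p) :=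
  (LinearEquiv.ofBijective _ ⟨F.sumMap_injective p, F.sumMap_surjective p⟩).symm

theorem stalkEquiv_symm_apply (t : ∀ i, MStalk A' (b i) p) :
    (F.stalkEquiv p).symm t = ∑ i, F.stalkMap i p (t i) :=
  F.sumMap_apply t

theorem stalkEquiv_sum_smul_gen (P : Fin k → DStalk p) :
    F.stalkEquiv p (∑ i, P i • F.gen i p) = fun i => (hypIdeal A' (b i) p).mkQ (P i) := by
  rw [← LinearEquiv.eq_symm_apply, stalkEquiv_symm_apply]
  simp only [stalkMap_mkQ]

theorem stalkMap_mem_RSec {i : Fin k} {U : Opens (Fin r → ℂ)}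
    {t : ∀ q : U, MStalk A' (b i) q.1} (ht : t ∈ MSec A' (b i) U) :
    (fun q : U => F.stalkMap i q.1 (t q)) ∈ RSec A β U := by
  refine mem_RSec_of_locally fun p => ?_
  obtain ⟨V, hV, hpV, P, hP, htP⟩ := ht p
  refine ⟨V, hV, hpV, ?_⟩
  have heq : resFun (F := RStalk A β) hV (fun q : U => F.stalkMap i q.1 (t q)) =
      (⟨P, hP⟩ : DSec V) • fun q : V => F.gen i q.1 :=
    funext fun q => congrArg (F.stalkMap i q.1) (htP q)
  rw [heq]
  exact Submodule.smul_mem _ _ (F.gen_mem_RSec i V)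

theorem restrictionIso (F : Presentation A β A' b) : RestrictionIso A β A' b := by
  refine restrictionIso_of_stalkEquiv F.stalkEquiv fun U s => ⟨fun hs i p => ?_, fun hs => ?_⟩
  · obtain ⟨V, hV, hpV, Q, hQ⟩ := F.exists_eq_sum_smul_gen hs p
    refine ⟨V, hV, hpV, (Q i).1, mem_DSec_of_mem_DPre (Q i).2, fun q => ?_⟩
    simp only [hQ, stalkEquiv_sum_smul_gen]
  · have heq : s = ∑ i, fun q : U => F.stalkMap i q.1 (F.stalkEquiv q.1 (s q) i) := by
      funext q
      rw [Finset.sum_apply, ← stalkEquiv_symm_apply, LinearEquiv.symm_apply_apply]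
    rw [heq]
    exact sum_mem fun i _ => F.stalkMap_mem_RSec (hs i)

end Presentation

end Sections

section Generators

variable {m r : ℕ} {a : Fin (m + r) → ℕ} {i₀ : Fin (m + r)} {β : ℂ} {U : Opens (Fin r → ℂ)}

/-- The section of the restriction over `U` given by the operator `∂_{i₀} ^ l`. -/
def powSec (a : Fin (m + r) → ℕ) (i₀ : Fin (m + r)) (β : ℂ) (l : ℕ) (U : Opens (Fin r → ℂ)) :
    ∀ q : U, RStalk (row a) β q.1 :=
  fun q => powClass a i₀ β l q.1

theorem powSec_mem_RSec (l : ℕ) : powSec a i₀ β l U ∈ RSec (row a) β U :=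
  fun _ => ⟨⊤, trivial, fun _ => pd i₀ ^ l,
    mem_DSec_of_mem_DPre (pow_mem (pd_mem_DPre (V := ⊤) i₀) l), fun _ _ => rfl⟩

variable {M : Submodule (DPre U) (∀ q : U, RStalk (row a) β q.1)}

theorem powSec_mem_of_mem_translate (ha₀ : a i₀ = 1) {c l : ℕ} (hc : powSec a i₀ β c U ∈ M)
    (hl : l ∈ translate (a ∘ Fin.natAdd m) c) : powSec a i₀ β l U ∈ M := by
  obtain ⟨u, rfl⟩ := hl
  have heq : powSec a i₀ β (c + (a ∘ Fin.natAdd m) ⬝ᵥ u) U =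
      (⟨_, pdPow_mem_DPre u⟩ : DPre U) • powSec a i₀ β c U := by
    exact funext fun q => (pdPow_smul_powClass ha₀ β u c).symm
  rw [heq]
  exact M.smul_mem _ hc

theorem smul_powClass_eq_sum {p : Fin r → ℂ} (ha₀ : a i₀ = 1) (l : ℕ) :
    algebraMap ℂ (DStalk p) (β - l) • powClass a i₀ β l p =
      ∑ j, (algebraMap ℂ (DStalk p) (a (Fin.natAdd m j)) * fn (coord j)) •
        powClass a i₀ β (l + a (Fin.natAdd m j)) p := by
  have h := euler_smul_powClass (p := p) ha₀ β l
  rw [euler, sub_smul, sub_eq_zero, Finset.sum_smul] at h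
  rw [← h]
  refine Finset.sum_congr rfl fun j _ => ?_
  have hpd : (pd j : DStalk p) • powClass a i₀ β l p =
      powClass a i₀ β (l + a (Fin.natAdd m j)) p := by
    rw [← pdPow_single_one, pdPow_smul_powClass ha₀, dotProduct_single_one,
      Function.comp_apply]
  rw [← hpd, ← mul_smul, Algebra.smul_def, mul_assoc]
  rfl

theorem powSec_mem_of_add_mem (ha₀ : a i₀ = 1) {l : ℕ} (hl : β ≠ l)
    (hM : ∀ j, powSec a i₀ β (l + a (Fin.natAdd m j)) U ∈ M) : powSec a i₀ β l U ∈ M := by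
  have heq : powSec a i₀ β l U = algebraMap ℂ (DPre U) (β - l)⁻¹ • ∑ j,
      (algebraMap ℂ (DPre U) (a (Fin.natAdd m j)) *
        ⟨_, fn_mem_DPre fun q => analyticAt_coord j q.1⟩) •
      powSec a i₀ β (l + a (Fin.natAdd m j)) U := by
    funext q
    change powClass a i₀ β l q.1 = algebraMap ℂ (DStalk q.1) (β - l)⁻¹ •
      (∑ j, (algebraMap ℂ (DPre U) (a (Fin.natAdd m j)) *
        ⟨_, fn_mem_DPre fun q => analyticAt_coord j q.1⟩) •
        powSec a i₀ β (l + a (Fin.natAdd m j)) U) q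
    rw [Finset.sum_apply]
    change powClass a i₀ β l q.1 = algebraMap ℂ (DStalk q.1) (β - l)⁻¹ •
      ∑ j, (algebraMap ℂ (DStalk q.1) (a (Fin.natAdd m j)) * fn (coord j)) •
        powClass a i₀ β (l + a (Fin.natAdd m j)) q.1
    rw [← smul_powClass_eq_sum ha₀, smul_smul, ← map_mul, inv_mul_cancel₀ (sub_ne_zero.2 hl),
      map_one, one_smul]
  rw [heq]
  exact M.smul_mem _ (sum_mem fun j _ => M.smul_mem _ (hM j))

theorem forall_nat_of_finite_compl {ι : Type*} {T : Set ℕ} (hT : Tᶜ.Finite) {s : ι → ℕ}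
    (hs : ∀ j, 0 < s j) {motive : ℕ → Prop} (mem : ∀ l ∈ T, motive l)
    (descent : ∀ l ∉ T, (∀ j, motive (l + s j)) → motive l) (l : ℕ) : motive l := by
  obtain ⟨N, hN⟩ := hT.bddAbove
  induction h : N + 1 - l using Nat.strong_induction_on generalizing l with
  | _ d ih =>
    by_cases hl : l ∈ T
    · exact mem l hl
    · have hlN : l ≤ N := hN hl
      exact descent l hl fun j => ih _ (by have := hs j; omega) _ rfl

variable {ι : Type*} {c : ι → ℕ}

theorem powSec_mem_span (ha₀ : a i₀ = 1) (ha : ∀ j, 0 < (a ∘ Fin.natAdd m) j)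
    (hfin : (⋃ i, translate (a ∘ Fin.natAdd m) (c i))ᶜ.Finite)
    (hβ : ∀ l : ℕ, β = l → l ∈ ⋃ i, translate (a ∘ Fin.natAdd m) (c i)) (l : ℕ) :
    powSec a i₀ β l U ∈ Submodule.span (DPre U) (Set.range fun i => powSec a i₀ β (c i) U) := by
  refine forall_nat_of_finite_compl (motive := fun l => powSec a i₀ β l U ∈ _) hfin ha
    (fun l hl => ?_) (fun l hl h => ?_) l
  · obtain ⟨i, hi⟩ := Set.mem_iUnion.1 hl
    exact powSec_mem_of_mem_translate ha₀ (Submodule.subset_span ⟨i, rfl⟩) hi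
  · exact powSec_mem_of_add_mem ha₀ (fun hl' => hl (hβ l hl')) h

theorem mk_mem_of_powSec_mem (ha₀ : a i₀ = 1) {V : Opens (Fin (m + r) → ℂ)}
    {M : Submodule (DPre (slice (m := m) V)) (∀ q : slice (m := m) V, RStalk (row a) β q.1)}
    (hM : ∀ l, powSec a i₀ β l _ ∈ M) {P : ∀ q : V, DStalk q.1} (hP : P ∈ DPre V) :
    (fun q : slice (m := m) V => RStalk.mk (row a) β q.1 (P ⟨incl m q.1, q.2⟩)) ∈ M := by
  refine DPre.induction_normalForm (motive := fun P => (fun q : slice (m := m) V =>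
    RStalk.mk (row a) β q.1 (P ⟨incl m q.1, q.2⟩)) ∈ M) hP (zero_mem _)
    (fun P Q hP hQ => add_mem hP hQ) fun f hf u => ?_
  have heq : (fun q : slice (m := m) V =>
      RStalk.mk (row a) β q.1 (fn (germ f (hf ⟨incl m q.1, q.2⟩)) * pdPow u)) =
      (⟨_, fn_mem_DPre fun q : slice (m := m) V =>
        analyticAt_comp_incl (hf ⟨incl m q.1, q.2⟩)⟩ : DPre (slice (m := m) V)) •
        powSec a i₀ β (a ⬝ᵥ u) _ := by
    funext q
    rw [rStalkMk_fn_mul, rStalkMk_pdPow ha₀]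
    rfl
  rw [heq]
  exact M.smul_mem _ (hM _)

variable {k : ℕ} {c : Fin k → ℕ}

theorem exists_eq_sum_smul_powClass (ha₀ : a i₀ = 1) (ha : ∀ j, 0 < (a ∘ Fin.natAdd m) j)
    (hfin : (⋃ i, translate (a ∘ Fin.natAdd m) (c i))ᶜ.Finite)
    (hβ : ∀ l : ℕ, β = l → l ∈ ⋃ i, translate (a ∘ Fin.natAdd m) (c i))
    {s : ∀ q : U, RStalk (row a) β q.1} (hs : s ∈ RSec (row a) β U) (p : U) :
    ∃ (V : Opens (Fin r → ℂ)) (h : V ≤ U), p.1 ∈ V ∧ ∃ Q : Fin k → DPre V,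
      ∀ q : V, s ⟨q.1, h q.2⟩ = ∑ i, (Q i).1 q • powClass a i₀ β (c i) q.1 := by
  obtain ⟨V, hpV, P, hP, hsP⟩ := hs p
  obtain ⟨W, hW, hpW, hPW⟩ := hP ⟨incl m p.1, hpV⟩
  obtain ⟨Q, hQ⟩ := (Submodule.mem_span_range_iff_exists_fun _).1
    (mk_mem_of_powSec_mem ha₀ (powSec_mem_span (c := c) ha₀ ha hfin hβ) hPW)
  refine ⟨slice W ⊓ U, inf_le_right, ⟨hpW, p.2⟩,
    fun i => ⟨_, resFun_mem_DPre inf_le_left (Q i).2⟩, fun q => ?_⟩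
  have hQq := congrFun hQ ⟨q.1, q.2.1⟩
  rw [Finset.sum_apply] at hQq
  exact (hsP ⟨q.1, q.2.2⟩ (hW q.2.1)).trans hQq.symm

/-- The presentation of the restriction by the classes of the powers `∂_{i₀} ^ cᵢ`, when the
translates by `cᵢ` of the semigroup of the last weights are disjoint and cover all but finitely many
natural numbers, and `β` is not one of the numbers left out. -/
def powPresentation (ha₀ : a i₀ = 1) (ha : ∀ j, 0 < (a ∘ Fin.natAdd m) j)
    (hc : Pairwise (Function.onFun Disjoint fun i => translate (a ∘ Fin.natAdd m) (c i)))
    (hfin : (⋃ i, translate (a ∘ Fin.natAdd m) (c i))ᶜ.Finite)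
    (hβ : ∀ l : ℕ, β = l → l ∈ ⋃ i, translate (a ∘ Fin.natAdd m) (c i)) :
    Presentation (row a) β (row (a ∘ Fin.natAdd m)) fun i => β - c i where
  gen i p := powClass a i₀ β (c i) p
  gen_mem_RSec i _ := powSec_mem_RSec (c i)
  sum_smul_gen_eq_zero_iff := sum_smul_powClass_eq_zero_iff ha₀ ha hc hβ
  exists_eq_sum_smul_gen := exists_eq_sum_smul_powClass ha₀ ha hfin hβ

end Generators

section Translates

variable {r k : ℕ} {s : Fin r → ℕ} {c : Fin k → ℕ}

theorem gcd_dvd_dotProduct (s u : Fin r → ℕ) : Finset.univ.gcd s ∣ s ⬝ᵥ u :=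
  Finset.dvd_sum fun _ hj => (Finset.gcd_dvd hj).mul_right _

theorem exists_forall_ge_eq_dotProduct (s : Fin r → ℕ) :
    ∃ N, ∀ l ≥ N, Finset.univ.gcd s ∣ l → ∃ u, l = s ⬝ᵥ u := by
  obtain ⟨N, hN⟩ := Nat.exists_mem_closure_of_ge (Set.range s)
  refine ⟨N, fun l hl hdvd => ?_⟩
  have hset : Nat.setGcd (Set.range s) ∣ Finset.univ.gcd s :=
    Finset.dvd_gcd fun j _ => Nat.setGcd_dvd_of_mem ⟨j, rfl⟩
  obtain ⟨u, rfl⟩ := AddSubmonoid.exists_of_mem_closure_range s l (hN l hl (hset.trans hdvd))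
  exact ⟨u, dotProduct_comm u s⟩

theorem gcd_natAbs_fin_two (f : Fin 2 → ℤ) :
    Finset.univ.gcd (fun j => (f j).natAbs) = Int.gcd (f 0) (f 1) := by
  simp [Fin.univ_succ, Int.gcd, gcd_eq_nat_gcd]

theorem pairwise_disjoint_translate (hs : k ∣ Finset.univ.gcd s) (hc : ∀ i, c i % k = i) :
    Pairwise (Function.onFun Disjoint fun i => translate s (c i)) := by
  have mod_eq : ∀ i, ∀ l ∈ translate s (c i), l % k = i := by
    rintro i _ ⟨u, rfl⟩
    obtain ⟨d, hd⟩ := hs.trans (gcd_dvd_dotProduct s u)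
    simp only [hd, Nat.add_mul_mod_self_left, hc]
  exact fun i j hij => Set.disjoint_left.2 fun l hi hj =>
    hij (Fin.ext ((mod_eq i l hi).symm.trans (mod_eq j l hj)))

theorem finite_compl_iUnion_translate (hs : Finset.univ.gcd s ∣ k) [NeZero k]
    (hc : ∀ i, c i % k = i) : (⋃ i, translate s (c i))ᶜ.Finite := by
  obtain ⟨N, hN⟩ := exists_forall_ge_eq_dotProduct s
  refine (Set.finite_Iio (N + ∑ i, c i)).subset fun l hl =>
    Set.mem_Iio.2 <| not_le.1 fun hle => hl ?_
  let i : Fin k := Fin.ofNat k l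
  have hi : c i ≤ ∑ i, c i := Finset.single_le_sum (fun _ _ => Nat.zero_le _) (Finset.mem_univ i)
  obtain ⟨u, hu⟩ := hN (l - c i) (by omega)
    (hs.trans ((Nat.modEq_iff_dvd' (by omega)).1 (hc i)))
  have hsum : c i + s ⬝ᵥ u = l := by omega
  exact Set.mem_iUnion.2 ⟨i, u, hsum⟩

end Translates

section Parameters

theorem euler_intCast_mul {n : ℕ} (κ : ℤ) (A : Fin n → ℤ) (β : ℂ) (p : Fin n → ℂ) :
    (euler (fun j => κ * A j) (κ * β) : DStalk p) =
      algebraMap ℂ (DStalk p) κ * euler A β := by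
  rw [euler, euler, mul_sub, Finset.mul_sum, map_mul]
  congr 1
  refine Finset.sum_congr rfl fun j _ => ?_
  rw [← Algebra.smul_def, smul_smul, Int.cast_mul]

theorem hypIdeal_intCast_mul {n : ℕ} {κ : ℤ} (hκ : κ ≠ 0) (A : Fin n → ℤ) (β : ℂ)
    (p : Fin n → ℂ) : hypIdeal (fun j => κ * A j) (κ * β) p = hypIdeal A β p := by
  have hker : ∀ u : Fin n → ℤ, ∑ j, κ * A j * u j = 0 ↔ ∑ j, A j * u j = 0 := by
    intro u
    simp only [mul_assoc, ← Finset.mul_sum, mul_eq_zero, hκ, false_or]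
  have hunit : IsUnit (algebraMap ℂ (DStalk p) κ) :=
    (isUnit_iff_ne_zero.2 (Int.cast_ne_zero.2 hκ)).map _
  simp only [hypIdeal, hker, euler_intCast_mul, Submodule.span_union]
  congr 1
  exact Submodule.span_singleton_group_smul_eq _ hunit.unit _

variable {m r k : ℕ} {A : Fin (m + r) → ℤ} {β : ℂ} {A' : Fin r → ℤ} {b : Fin k → ℂ}

/-- A presentation of the restriction by hypergeometric systems with given ideals is one by any
other hypergeometric systems with the same ideals. -/
def Presentation.ofHypIdealEq {B : Fin r → ℤ} {d : Fin k → ℂ} (F : Presentation A β A' b)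
    (h : ∀ i p, hypIdeal B (d i) p = hypIdeal A' (b i) p) : Presentation A β B d where
  gen := F.gen
  gen_mem_RSec := F.gen_mem_RSec
  sum_smul_gen_eq_zero_iff P := by simp only [h, F.sum_smul_gen_eq_zero_iff]
  exists_eq_sum_smul_gen := F.exists_eq_sum_smul_gen

variable {a : Fin (m + r) → ℕ} {i₀ : Fin (m + r)} {κ : ℤ} {c : Fin k → ℕ}

theorem restrictionIso_of_mod_eq [NeZero k] (ha₀ : a i₀ = 1) (ha : ∀ j, 0 < (a ∘ Fin.natAdd m) j)
    (hκ : κ ≠ 0) (hA' : ∀ j, (a (Fin.natAdd m j) : ℤ) = κ * A' j)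
    (hk : Finset.univ.gcd (a ∘ Fin.natAdd m) = k) (hc : ∀ i, c i % k = i)
    (hβ : ∀ l : ℕ, β = l → l ∈ ⋃ i, translate (a ∘ Fin.natAdd m) (c i)) :
    RestrictionIso (row a) β A' fun i => (β - c i) / κ := by
  refine ((powPresentation ha₀ ha (pairwise_disjoint_translate hk.symm.dvd hc)
    (finite_compl_iUnion_translate hk.dvd hc) hβ).ofHypIdealEq fun i p => ?_).restrictionIso
  rw [← hypIdeal_intCast_mul hκ, mul_div_cancel₀ _ (Int.cast_ne_zero.2 hκ)]
  simp only [← hA']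
  rfl

theorem exists_restrictionIso [NeZero k] (ha₀ : a i₀ = 1) (ha : ∀ j, 0 < (a ∘ Fin.natAdd m) j)
    (hκ : κ ≠ 0) (hA' : ∀ j, (a (Fin.natAdd m j) : ℤ) = κ * A' j)
    (hk : Finset.univ.gcd (a ∘ Fin.natAdd m) = k) (β : ℂ) :
    ∃ b : Fin k → ℂ, RestrictionIso (row a) β A' b := by
  by_cases hβ : ∃ l : ℕ, β = l
  · obtain ⟨l, rfl⟩ := hβ
    let c : Fin k → ℕ := Function.update (fun i => i) (Fin.ofNat k l) l
    have hc : ∀ i, c i % k = i := fun i => by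
      obtain rfl | hi := eq_or_ne i (Fin.ofNat k l)
      · simp only [c, Function.update_self, Fin.val_ofNat]
      · simp only [c, Function.update_of_ne hi, Nat.mod_eq_of_lt i.2]
    refine ⟨_, restrictionIso_of_mod_eq ha₀ ha hκ hA' hk hc fun l' hl' => ?_⟩
    obtain rfl := Nat.cast_injective hl'
    exact Set.mem_iUnion.2 ⟨Fin.ofNat k l, 0, by simp [c]⟩
  · exact ⟨_, restrictionIso_of_mod_eq ha₀ ha hκ hA' hk (fun i => Nat.mod_eq_of_lt i.2)
      fun l hl => absurd ⟨l, hl⟩ hβ⟩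

theorem finite_not_restrictionIso [NeZero k] (ha₀ : a i₀ = 1)
    (ha : ∀ j, 0 < (a ∘ Fin.natAdd m) j) (hκ : κ ≠ 0)
    (hA' : ∀ j, (a (Fin.natAdd m j) : ℤ) = κ * A' j)
    (hk : Finset.univ.gcd (a ∘ Fin.natAdd m) = k) :
    {β : ℂ | ¬ RestrictionIso (row a) β A' fun i : Fin k => (β - (i : ℕ)) / κ}.Finite := by
  have hmod : ∀ i : Fin k, (i : ℕ) % k = i := fun i => Nat.mod_eq_of_lt i.2
  refine ((finite_compl_iUnion_translate hk.dvd hmod).image (fun l : ℕ => (l : ℂ))).subset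
    fun β hβ => by_contra fun hβ' => hβ ?_
  exact restrictionIso_of_mod_eq ha₀ ha hκ hA' hk hmod fun l hl =>
    by_contra fun hlc => hβ' ⟨l, hlc, hl.symm⟩

end Parameters

end GKZ

end

theorem mainTheorem6_general {m r k : ℕ} [NeZero r] {A : Fin (m + r) → ℤ} {i₀ : Fin (m + r)}
    (hA₀ : A i₀ = 1) (hA : ∀ i, 0 ≤ A i) (hpos : ∀ j, 0 < A (Fin.natAdd m j)) {κ : ℤ}
    {A' : Fin r → ℤ} (hA' : ∀ j, A (Fin.natAdd m j) = κ * A' j)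
    (hk : Finset.univ.gcd (fun j => (A (Fin.natAdd m j)).natAbs) = k) :
    (∀ β : ℂ, ∃ b : Fin k → ℂ, GKZ.RestrictionIso A β A' b) ∧
      {β : ℂ | ¬ GKZ.RestrictionIso A β A' fun i : Fin k => (β - (i : ℕ)) / κ}.Finite := by
  lift A to Fin (m + r) → ℕ using hA
  have ha₀ : A i₀ = 1 := Nat.cast_injective hA₀
  have ha : ∀ j, 0 < (A ∘ Fin.natAdd m) j := fun j => Nat.cast_pos.1 (hpos j)
  have hκ : κ ≠ 0 := left_ne_zero_of_mul ((hA' 0).symm.trans_ne (hpos 0).ne')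
  have : NeZero k := ⟨fun hk0 =>
    (ha 0).ne' (Finset.gcd_eq_zero_iff.1 (hk.trans hk0) 0 (Finset.mem_univ 0))⟩
  exact ⟨GKZ.exists_restrictionIso ha₀ ha hκ hA' hk,
    GKZ.finite_not_restrictionIso ha₀ ha hκ hA' hk⟩

theorem mainTheorem6 :
    (∀ k a b : ℕ, 1 ≤ a → a < b → 1 < k * a → k * a < k * b → Nat.Coprime a b →
      (∀ β : ℂ, ∃ β' : Fin k → ℂ,
        GKZ.RestrictionIso (m := 1) (r := 2) ![1, (k * a : ℤ), (k * b : ℤ)] β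
          ![(a : ℤ), (b : ℤ)] β') ∧
      {β : ℂ | ¬ GKZ.RestrictionIso (m := 1) (r := 2) ![1, (k * a : ℤ), (k * b : ℤ)] β
          ![(a : ℤ), (b : ℤ)] (fun i : Fin k => (β - (i : ℕ)) / k)}.Finite) ∧
    (∀ (m : ℕ) (A : Fin (m + 2) → ℤ), A 0 = 1 → StrictMono A →
      (∀ β : ℂ, ∃ β' : Fin (Int.gcd (A (Fin.natAdd m 0)) (A (Fin.natAdd m 1))) → ℂ,
        GKZ.RestrictionIso (m := m) (r := 2) A β
          ![A (Fin.natAdd m 0), A (Fin.natAdd m 1)] β') ∧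
      {β : ℂ | ¬ GKZ.RestrictionIso (m := m) (r := 2) A β
          ![A (Fin.natAdd m 0), A (Fin.natAdd m 1)]
          (fun i : Fin (Int.gcd (A (Fin.natAdd m 0)) (A (Fin.natAdd m 1))) =>
            β - (i : ℕ))}.Finite) := by
  refine ⟨fun k a b _ _ hka hkab hco => ?_, fun m A hA0 hmono => ?_⟩
  · have hgcd : Finset.univ.gcd (fun j : Fin 2 =>
        ((![1, k * a, k * b] : Fin (1 + 2) → ℤ) (Fin.natAdd 1 j)).natAbs) = k := by
      refine (GKZ.gcd_natAbs_fin_two _).trans ?_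
      change Int.gcd (k * a) (k * b) = k
      rw [Int.gcd_mul_left, Int.gcd_natCast_natCast, hco, mul_one, Int.natAbs_natCast]
    have hpos : ∀ i, 0 < (![1, k * a, k * b] : Fin (1 + 2) → ℤ) i := by
      rw [Fin.forall_fin_succ, Fin.forall_fin_two]
      exact ⟨one_pos, by simpa using by omega⟩
    simpa only [Int.cast_natCast] using mainTheorem6_general (κ := k) (i₀ := 0) rfl
      (fun i => (hpos i).le) (fun j => hpos _) (Fin.forall_fin_two.2 ⟨rfl, rfl⟩) hgcd
  · have hpos : ∀ i, 0 < A i := fun i =>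
      one_pos.trans_le (hA0.symm.trans_le (hmono.monotone (Fin.zero_le i)))
    simpa only [Int.cast_one, div_one] using mainTheorem6_general hA0 (fun i => (hpos i).le)
      (fun j => hpos _) (κ := 1) (Fin.forall_fin_two.2 ⟨(one_mul _).symm, (one_mul _).symm⟩)
      (GKZ.gcd_natAbs_fin_two _)
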